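/- **Notation.** Let $e_0=0$, $e_{j+1}=e^{e_j}$; $\ln_1(\cdot)=\ln(\cdot)$, $\ln_{j+1}(\cdot)=\ln(\ln_j(\cdot))$; $L_1(\cdot)=(1-\ln(\cdot))^{-1}$, $L_{j+1}(\cdot)=L_1(L_j(\cdot))$. For $m\in\mathbb N=\{1,2,\dots\}$ and $\alpha\in\mathbb R$ let $$A(m,\alpha)=\prod_{j=1}^m\Big(\frac{2j-1-\alpha}{2}\Big)^2,\qquad B(m,\alpha)=\frac1{4^m}\sum_{k=1}^m\ \prod_{1\le j\le m,\ j\ne k}(2j-1-\alpha)^2,$$ $$\sum_{i=0}^{2m}c_i(m,\alpha)\lambda^i=\prod_{j=1}^m\Big(\lambda^2-\frac{(2j-1-\alpha)^2}{4}\Big).$$ Let $\rho\in(0,\infty)$, let $I$ be $(\rho,\infty)$ or $(0,\rho)$, and let $$|||f|||_{m,\alpha}^2=\int_I x^\alpha|f^{(m)}(x)|^2\,dx,\qquad \|f\|_{m,\alpha}^2=\sum_{k=0}^m\int_I x^\alpha|f^{(k)}(x)|^2\,dx .$$ $H_0^m(I;x^\alpha dx)$ is the closure of $C_0^\infty(I)$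 (complex-valued functions) in the norm $\|\cdot\|_{m,\alpha}$, taken in the space of all $f$ on $I$ with $f,\dots,f^{(m-1)}$ locally absolutely continuous and $\|f\|_{m,\alpha}<\infty$. The homogeneous space $\dot H_0^m(I;x^\alpha dx)$ is the closure of $C_0^\infty(I)$ in the norm $|||\cdot|||_{m,\alpha}$, taken in the space of all $f$ on $I$ with $f,\dots,f^{(m-1)}$ locally absolutely continuous, $f^{(k)}(x)\to0$ as $x\to\rho$, $x\in I$ $(0\le k\le m-1)$, and $|||f|||_{m,\alpha}<\infty$. For $\ell,N\in\mathbb N$, functions $\Lambda_1,\Lambda_2,\dots$ on $I$ and a function $h$ on $I$ put $$\begin{aligned}S_I[\Lambda;h]={}&A(\ell,\alpha)\int_I x^{\alpha-2\ell}|h|^2dx+B(\ell,\alpha)\sum_{k=1}^N\int_I x^{\alpha-2\ell}\prod_{p=1}^k\Lambda_p(x)^2\,|h|^2dx\\&+\sum_{j=2}^\ell|c_{2j}(\ell,\alpha)|A(j,0)\int_I x^{\alpha-2\ell}\Lambda_1(x)^{2j}|h|^2dx\\&+\sum_{j=2}^\ell|c_{2j}(\ell,\alpha)|B(j,0)\sum_{k=1}^{N-1}\int_I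 x^{\alpha-2\ell}\Lambda_1(x)^{2j}\prod_{p=1}^k\Lambda_{p+1}(x)^2\,|h|^2dx,\end{aligned}$$ where empty sums are $0$ and the first term is omitted if $A(\ell,\alpha)=0$ (i.e., if $\alpha\in\{2j-1\}_{1\le j\le\ell}$). **Theorem.** Let $\ell,m,N\in\mathbb N$ with $1\le\ell\le m$, $\alpha\in\mathbb R$, and $\rho,\gamma,\tau\in(0,\infty)$. (i) If $\rho\ge e_N\gamma$, then for all $f\in\dot H_0^m((\rho,\infty);x^\alpha dx)$, $$\int_\rho^\infty x^\alpha|f^{(m)}(x)|^2dx\ \ge\ S_{(\rho,\infty)}[\Lambda;f^{(m-\ell)}]\quad\text{with }\Lambda_p(x)=[\ln_p(x/\gamma)]^{-1}.$$ (ii) If $\rho\ge\tau$, then the same inequality holds for all $f\in\dot H_0^m((\rho,\infty);x^\alpha dx)$ with $\Lambda_p(x)=L_p(\tau/x)$. Moreover, $\dot H_0^m((0,\rho);x^\alpha dx)=H_0^m((0,\rho);x^\alpha dx)$, and: (iii) If $\gamma\ge e_N\rho$, then for all $f\in\dot H_0^m((0,\rho);x^\alpha dx)$, $$\int_0^\rho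 x^\alpha|f^{(m)}(x)|^2dx\ \ge\ S_{(0,\rho)}[\Lambda;f^{(m-\ell)}]\quad\text{with }\Lambda_p(x)=[\ln_p(\gamma/x)]^{-1}.$$ (iv) If $\tau\ge\rho$, then the same inequality holds for all $f\in\dot H_0^m((0,\rho);x^\alpha dx)$ with $\Lambda_p(x)=L_p(x/\tau)$. -/

import Mathlib

open MeasureTheory Set Filter Topology
open scoped ContDiff ENNReal

noncomputable section

/-- Iterated exponentials: `e₀ = 0`, `e_{j+1} = exp (e_j)`. -/
def iterExp : ℕ → ℝ
  | 0 => 0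
  | j + 1 => Real.exp (iterExp j)

/-- Iterated logarithms: `ln₁ = ln`, `ln_{j+1} = ln ∘ ln_j` (index `0` is the identity). -/
def iterLog : ℕ → ℝ → ℝ
  | 0, x => x
  | j + 1, x => Real.log (iterLog j x)

/-- Normalized iterated logarithms: `L₁ s = (1 - ln s)⁻¹`, `L_{j+1} = L₁ ∘ L_j`
(index `0` is the identity). -/
def normLog : ℕ → ℝ → ℝ
  | 0, s => s
  | j + 1, s => (1 - Real.log (normLog j s))⁻¹

/-- `A(m, α) = ∏_{j=1}^m ((2j - 1 - α) / 2)²`. -/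
def constA (m : ℕ) (α : ℝ) : ℝ :=
  ∏ j ∈ Finset.Icc 1 m, ((2 * (j : ℝ) - 1 - α) / 2) ^ 2

/-- `B(m, α) = 4^{-m} ∑_{k=1}^m ∏_{1 ≤ j ≤ m, j ≠ k} (2j - 1 - α)²`. -/
def constB (m : ℕ) (α : ℝ) : ℝ :=
  1 / 4 ^ m * ∑ k ∈ Finset.Icc 1 m, ∏ j ∈ (Finset.Icc 1 m).erase k, (2 * (j : ℝ) - 1 - α) ^ 2

/-- `P_{m,α}(λ) = ∏_{j=1}^m (λ² - (2j - 1 - α)² / 4)`. -/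
def polyP (m : ℕ) (α : ℝ) : Polynomial ℝ :=
  ∏ j ∈ Finset.Icc 1 m, (Polynomial.X ^ 2 - Polynomial.C ((2 * (j : ℝ) - 1 - α) ^ 2 / 4))

/-- `c_i(m, α)`, the coefficient of `λ^i` in `P_{m,α}`. -/
def coeffC (i m : ℕ) (α : ℝ) : ℝ := (polyP m α).coeff i

/-- `C₀^∞(U)`: smooth complex-valued functions with compact support contained in `U`. -/
def testFunctions (U : Set ℝ) : Set (ℝ → ℂ) :=
  {φ | ContDiff ℝ ∞ φ ∧ HasCompactSupport φ ∧ tsupport φ ⊆ U}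

/-- `|||f|||²_{m,α} = ∫_U x^α |f^{(m)}(x)|² dx`, as an element of `[0, ∞]`. -/
def homNormSq (U : Set ℝ) (m : ℕ) (α : ℝ) (f : ℝ → ℂ) : ℝ≥0∞ :=
  ∫⁻ x in U, ENNReal.ofReal (x ^ α * ‖iteratedDeriv m f x‖ ^ 2)

/-- `‖f‖²_{m,α} = ∑_{k=0}^m ∫_U x^α |f^{(k)}(x)|² dx`, as an element of `[0, ∞]`. -/
def sobNormSq (U : Set ℝ) (m : ℕ) (α : ℝ) (f : ℝ → ℂ) : ℝ≥0∞ :=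
  ∑ k ∈ Finset.range (m + 1), homNormSq U k α f

/-- `f, f', …, f^{(m-1)}` are absolutely continuous on every compact interval contained in the
open set `U`. For `m ≥ 1`, `f` is then of class `C^{m-1}` on `U`, and `f^{(m)}` exists almost
everywhere in `U` and is the weak derivative of order `m` of `f`. Only the values of `f` on `U`
matter. -/
def LocACDerivs (U : Set ℝ) (m : ℕ) (f : ℝ → ℂ) : Prop :=
  ∀ k < m, ∀ a b : ℝ, a ≤ b → Icc a b ⊆ U → AbsolutelyContinuousOnInterval (iteratedDeriv k f) a b

/-- The weighted Sobolev space `H^m(U; x^α dx)` on an open interval `U ⊆ (0, ∞)`: all derivatives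
of order at most `m` lie in `L²(U; x^α dx)`. Every class of functions is represented by its
continuous representative. -/
def sobolev (U : Set ℝ) (m : ℕ) (α : ℝ) : Set (ℝ → ℂ) :=
  {f | LocACDerivs U m f ∧ sobNormSq U m α f < ⊤}

/-- `H₀^m(U; x^α dx)`: the closure of `C₀^∞(U)` in the norm `‖·‖_{m,α}`. -/
def sobolevZero (U : Set ℝ) (m : ℕ) (α : ℝ) : Set (ℝ → ℂ) :=
  {f | f ∈ sobolev U m α ∧ ∀ ε : ℝ≥0∞, 0 < ε → ∃ φ ∈ testFunctions U, sobNormSq U m α (f - φ) < ε}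

/-- For an open interval `U` with endpoint `ρ ∈ (0, ∞)`: the functions `f` on `U` whose derivatives
`f^{(k)}`, `k < m`, are locally absolutely continuous with boundary value `0` at `ρ`, and whose
`m`-th derivative lies in `L²(U; x^α dx)`. This is a Hilbert space with the norm `|||·|||_{m,α}`;
the boundary condition removes the polynomials of degree less than `m`. -/
def homSobolev (U : Set ℝ) (ρ : ℝ) (m : ℕ) (α : ℝ) : Set (ℝ → ℂ) :=
  {f | LocACDerivs U m f ∧ (∀ k < m, Tendsto (iteratedDeriv k f) (𝓝[U] ρ) (𝓝 0)) ∧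
    homNormSq U m α f < ⊤}

/-- The homogeneous weighted Sobolev space `Ḣ₀^m(U; x^α dx)`, where `U` is `(ρ, ∞)` or `(0, ρ)`:
the closure of `C₀^∞(U)` in the norm `|||·|||_{m,α}`. -/
def homSobolevZero (U : Set ℝ) (ρ : ℝ) (m : ℕ) (α : ℝ) : Set (ℝ → ℂ) :=
  {f | f ∈ homSobolev U ρ m α ∧
    ∀ ε : ℝ≥0∞, 0 < ε → ∃ φ ∈ testFunctions U, homNormSq U m α (f - φ) < ε}

/-- `∫_U x^{α - 2ℓ} W(x) |h(x)|² dx`, as an element of `[0, ∞]`. -/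
def weightedInt (U : Set ℝ) (ℓ : ℕ) (α : ℝ) (W : ℝ → ℝ) (h : ℝ → ℂ) : ℝ≥0∞ :=
  ∫⁻ x in U, ENNReal.ofReal (x ^ (α - 2 * (ℓ : ℝ)) * W x * ‖h x‖ ^ 2)

/-- The right-hand side of the refined inequality, in terms of `h = f^{(m-ℓ)}` and of the
logarithmic factors `Λ p x`. All four groups of terms are nonnegative, and a group whose
coefficient is `0` contributes `0`, even if its integral is infinite. -/
def refinedSum (U : Set ℝ) (ℓ N : ℕ) (α : ℝ) (Λ : ℕ → ℝ → ℝ) (h : ℝ → ℂ) : ℝ≥0∞ :=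
  ENNReal.ofReal (constA ℓ α) * weightedInt U ℓ α (fun _ => 1) h
  + ENNReal.ofReal (constB ℓ α) * ∑ k ∈ Finset.Icc 1 N,
      weightedInt U ℓ α (fun x => ∏ p ∈ Finset.Icc 1 k, Λ p x ^ 2) h
  + ∑ j ∈ Finset.Icc 2 ℓ, ENNReal.ofReal (|coeffC (2 * j) ℓ α| * constA j 0) *
      weightedInt U ℓ α (fun x => Λ 1 x ^ (2 * j)) h
  + ∑ j ∈ Finset.Icc 2 ℓ, ENNReal.ofReal (|coeffC (2 * j) ℓ α| * constB j 0) *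
      ∑ k ∈ Finset.Icc 1 (N - 1),
        weightedInt U ℓ α (fun x => Λ 1 x ^ (2 * j) * ∏ p ∈ Finset.Icc 1 k, Λ (p + 1) x ^ 2) h

end

/-!
The idea is to pass to a logarithmic variable, in which the operator `d^ℓ/dx^ℓ` has constant
coefficients, and to iterate.

Let `h` be a test function on an interval `U ⊆ (0, ∞)`. With `x = c e^{σ t}`, `σ = ±1`, and
`h(x) = x^s w(t)` for `s = (2ℓ - 1 - α) / 2`, the integral `∫ x^α |h^{(ℓ)}|² dx` becomes
`∫ |∏_{j ≤ ℓ} (± d/dt + (2j - 1 - α) / 2) w|² dt`. For each factor the cross term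
`2 Re ⟨w, w'⟩ = (|w|²)'` integrates to zero, so the integral equals
`∑_i |c_{2i}(ℓ, α)| ∫ |w^{(i)}|² dt` (`homNormSq_eq_sum`). The term `i = 0` is the one with
`A(ℓ, α) = |c_0|`. Since `|c_2| = 4 B(ℓ, α)`, the other terms reduce the inequality with `N + 1`
logarithmic factors to the unweighted inequalities, of all orders `i ≥ 1`, with `N` factors in the
variable `t`: there the first factor is `1 / t`, and the next ones are the same iterated
logarithms shifted by one (`refinedSum_le_homNormSq`). Induction on `N` starts with the
Hardy–Rellich inequality without refinement (`LogHardy.zero`), which is the term `i = 0` again. The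
four cases of the theorem are `t = ln (x / γ)`, `t = 1 + ln (x / τ)`, `t = ln (γ / x)` and
`t = 1 + ln (τ / x)`.

For the closure of the test functions, the boundary condition at `ρ` bounds the values of
`g, …, g^{(m-1)}` at each point by the homogeneous norm of `g`
(`IsIntervalWithEndpoint.exists_enorm_sq_le_homNormSq`). Hence the derivatives of approximating
test functions converge pointwise, and Fatou's lemma transfers the inequalities
(`lintegral_le_homNormSq_of_testFunctions`).

On `(0, ρ)` the logarithmic term of the inequality dominates `x^α`, because `B > 0`, so the
homogeneous norm controls the inhomogeneous one on `Ḣ₀^m`. Conversely, the inhomogeneous norm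
controls `sup |g^{(k)}|`, `k < m`, near `ρ`, so that elements of `H₀^m` satisfy the boundary
condition.
-/

/-! ### Test functions -/

theorem testFunctions_mono {U V : Set ℝ} (hUV : U ⊆ V) {φ : ℝ → ℂ} (hφ : φ ∈ testFunctions U) :
    φ ∈ testFunctions V := ⟨hφ.1, hφ.2.1, hφ.2.2.trans hUV⟩

theorem testFunctions_deriv {U : Set ℝ} {φ : ℝ → ℂ} (hφ : φ ∈ testFunctions U) :
    deriv φ ∈ testFunctions U :=
  ⟨(contDiff_infty_iff_deriv.1 hφ.1).2, hφ.2.1.deriv, tsupport_deriv_subset.trans hφ.2.2⟩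

theorem testFunctions_iteratedDeriv {U : Set ℝ} {φ : ℝ → ℂ} (hφ : φ ∈ testFunctions U) (k : ℕ) :
    iteratedDeriv k φ ∈ testFunctions U := by
  induction k with
  | zero => simpa using hφ
  | succ k ih => rw [iteratedDeriv_succ]; exact testFunctions_deriv ih

theorem testFunctions_sub {U : Set ℝ} {φ ψ : ℝ → ℂ} (hφ : φ ∈ testFunctions U)
    (hψ : ψ ∈ testFunctions U) : φ - ψ ∈ testFunctions U :=
  ⟨hφ.1.sub hψ.1, hφ.2.1.sub hψ.2.1,
    (tsupport_sub φ ψ).trans (union_subset hφ.2.2 hψ.2.2)⟩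

theorem testFunctions_eq_zero {U : Set ℝ} {φ : ℝ → ℂ} (hφ : φ ∈ testFunctions U) {x : ℝ}
    (hx : x ∉ U) : φ x = 0 := image_eq_zero_of_notMem_tsupport fun h => hx (hφ.2.2 h)

theorem testFunctions_differentiable {U : Set ℝ} {φ : ℝ → ℂ} (hφ : φ ∈ testFunctions U) :
    Differentiable ℝ φ := hφ.1.differentiable (by simp)

theorem testFunctions_integrable_norm_sq {U : Set ℝ} {φ : ℝ → ℂ} (hφ : φ ∈ testFunctions U) :
    Integrable fun t => ‖φ t‖ ^ 2 :=
  (hφ.1.continuous.norm.pow 2).integrable_of_hasCompactSupport (hφ.2.1.mono fun t ht => by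
    contrapose! ht
    simp [Function.notMem_support.1 ht])

/-! ### Energy identity for products of first-order operators -/

/-- The cross term `Re ⟨u, u'⟩` is half the derivative of `‖u‖²`, so it integrates to zero. -/
theorem integral_norm_sq_smul_deriv_add {u : ℝ → ℂ} (hu : u ∈ testFunctions univ) {σ a : ℝ}
    (hσ : σ ^ 2 = 1) :
    ∫ t, ‖σ • deriv u t + a • u t‖ ^ 2
      = (∫ t, ‖deriv u t‖ ^ 2) + a ^ 2 * ∫ t, ‖u t‖ ^ 2 := by
  have hd : ∀ t, HasDerivAt (fun t => ‖u t‖ ^ 2) (2 * inner ℝ (u t) (deriv u t)) t := fun t =>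
    (testFunctions_differentiable hu t).hasDerivAt.norm_sq
  have hcd : Continuous (deriv u) := (testFunctions_deriv hu).1.continuous
  have hi : Integrable fun t => 2 * inner ℝ (u t) (deriv u t) := by
    refine Continuous.integrable_of_hasCompactSupport
      (continuous_const.mul (hu.1.continuous.inner hcd)) ?_
    refine hu.2.1.mono fun t ht => ?_
    contrapose! ht
    simp [Function.notMem_support.1 ht]
  have h0 := integral_eq_zero_of_hasDerivAt_of_integrable hd hi
    (testFunctions_integrable_norm_sq hu)
  have hpt : ∀ t, ‖σ • deriv u t + a • u t‖ ^ 2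
      = (‖deriv u t‖ ^ 2 + a ^ 2 * ‖u t‖ ^ 2) + σ * a * (2 * inner ℝ (u t) (deriv u t)) := by
    intro t
    rw [norm_add_sq_real, norm_smul, norm_smul, mul_pow, mul_pow, inner_smul_left,
      inner_smul_right, real_inner_comm, Real.norm_eq_abs, Real.norm_eq_abs, sq_abs, sq_abs, hσ]
    simp only [conj_trivial]
    ring
  simp_rw [hpt]
  have hi1 := testFunctions_integrable_norm_sq (testFunctions_deriv hu)
  have hi2 := (testFunctions_integrable_norm_sq hu).const_mul (a ^ 2)
  have hi3 : Integrable fun t => ‖deriv u t‖ ^ 2 + a ^ 2 * ‖u t‖ ^ 2 := hi1.add hi2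
  rw [integral_add hi3 (hi.const_mul _), integral_add hi1 hi2,
    integral_const_mul, integral_const_mul, h0]
  ring

/-- Iterating the energy identity: the energies of the lower-order derivatives occur with the
coefficients of `∏ (X + aⱼ²)`. -/
theorem integral_norm_sq_eq_sum_coeff {u : ℕ → ℝ → ℂ} {a : ℕ → ℝ} {σ : ℝ} (hσ : σ ^ 2 = 1)
    (hu : ∀ k, u k ∈ testFunctions univ)
    (hrec : ∀ k, u (k + 1) = fun t => σ • deriv (u k) t + a k • u k t) (k n : ℕ) :
    ∫ t, ‖iteratedDeriv n (u k) t‖ ^ 2 = ∑ i ∈ Finset.range (k + 1),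
      (∏ j ∈ Finset.range k, (Polynomial.X + Polynomial.C (a j ^ 2))).coeff i *
        ∫ t, ‖iteratedDeriv (i + n) (u 0) t‖ ^ 2 := by
  induction k generalizing n with
  | zero => simp
  | succ k ih =>
    have hstep : ∫ t, ‖iteratedDeriv n (u (k + 1)) t‖ ^ 2
        = (∫ t, ‖iteratedDeriv (n + 1) (u k) t‖ ^ 2)
          + a k ^ 2 * ∫ t, ‖iteratedDeriv n (u k) t‖ ^ 2 := by
      rw [iteratedDeriv_succ (n := n),
        ← integral_norm_sq_smul_deriv_add (testFunctions_iteratedDeriv (hu k) n) hσ]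
      congr 1
      ext t
      congr 2
      have e : u (k + 1) = σ • deriv (u k) + a k • u k := by
        rw [hrec k]; rfl
      have c1 : ContDiffAt ℝ n (deriv (u k)) t :=
        ((testFunctions_deriv (hu k)).1.of_le (by exact_mod_cast le_top)).contDiffAt
      have c2 : ContDiffAt ℝ n (u k) t :=
        ((hu k).1.of_le (by exact_mod_cast le_top)).contDiffAt
      have c3 : ContDiffAt ℝ n (σ • deriv (u k)) t := c1.const_smul σ
      have c4 : ContDiffAt ℝ n (a k • u k) t := c2.const_smul (a k)
      rw [e, iteratedDeriv_add c3 c4,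
        iteratedDeriv_const_smul c1, iteratedDeriv_const_smul c2, ← iteratedDeriv_succ',
        iteratedDeriv_succ]
    set R := ∏ j ∈ Finset.range k, (Polynomial.X + Polynomial.C (a j ^ 2)) with hR
    have hdeg : R.coeff (k + 1) = 0 := by
      apply Polynomial.coeff_eq_zero_of_natDegree_lt
      have : R.natDegree ≤ ∑ j ∈ Finset.range k, 1 := by
        refine (Polynomial.natDegree_prod_le _ _).trans (Finset.sum_le_sum fun j _ => ?_)
        rw [Polynomial.natDegree_X_add_C]
      simp at this
      omega
    rw [hstep, ih, ih, Finset.prod_range_succ, ← hR, Finset.sum_range_succ' _ (k + 1)]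
    have e0 : (R * (Polynomial.X + Polynomial.C (a k ^ 2))).coeff 0 = a k ^ 2 * R.coeff 0 := by
      rw [mul_add, Polynomial.coeff_add, Polynomial.coeff_mul_X_zero, Polynomial.coeff_mul_C,
        zero_add, mul_comm]
    have e1 : ∀ i, (R * (Polynomial.X + Polynomial.C (a k ^ 2))).coeff (i + 1)
        = R.coeff i + a k ^ 2 * R.coeff (i + 1) := by
      intro i
      rw [mul_add, Polynomial.coeff_add, Polynomial.coeff_mul_X, Polynomial.coeff_mul_C,
        mul_comm (a k ^ 2)]
    simp only [e0, e1, add_mul, Finset.sum_add_distrib]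
    have e2 : ∑ i ∈ Finset.range (k + 1), a k ^ 2 * R.coeff (i + 1) *
          (∫ t, ‖iteratedDeriv (i + 1 + n) (u 0) t‖ ^ 2)
        + a k ^ 2 * R.coeff 0 * (∫ t, ‖iteratedDeriv (0 + n) (u 0) t‖ ^ 2)
        = a k ^ 2 * ∑ i ∈ Finset.range (k + 1), R.coeff i *
          ∫ t, ‖iteratedDeriv (i + n) (u 0) t‖ ^ 2 := by
      rw [← Finset.sum_range_succ' (fun i => a k ^ 2 * R.coeff i *
          (∫ t, ‖iteratedDeriv (i + n) (u 0) t‖ ^ 2)), Finset.sum_range_succ, hdeg,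
        Finset.mul_sum]
      simp [mul_assoc]
    have e3 : ∀ i, i + (n + 1) = i + 1 + n := fun i => by ring
    simp only [e3]
    linarith

/-! ### Coefficients -/

theorem polyP_eq (m : ℕ) (α : ℝ) :
    polyP m α = (∏ j ∈ Finset.Icc 1 m,
      (Polynomial.X - Polynomial.C (((2 * (j : ℝ) - 1 - α) / 2) ^ 2))).comp (Polynomial.X ^ 2) := by
  rw [polyP, Polynomial.prod_comp]
  refine Finset.prod_congr rfl fun j _ => ?_
  simp [div_pow]
  norm_num

/-- The coefficients `c_{2i}` alternate in sign, and their absolute values are the coefficients of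
`∏ (X + aⱼ²)` with `aⱼ = (2j - 1 - α) / 2`. -/
theorem abs_coeffC (i m : ℕ) (α : ℝ) :
    |coeffC (2 * i) m α| = (∏ j ∈ Finset.Icc 1 m,
      (Polynomial.X + Polynomial.C (((2 * (j : ℝ) - 1 - α) / 2) ^ 2))).coeff i := by
  -- The sign rule needs `c_{2i}` and `c_{2i+2}` of the shorter product, hence the induction on `m`
  -- for all `i` at once, with nonnegativity of the unsigned coefficients.
  have key : ∀ (m i : ℕ), (∏ j ∈ Finset.Icc 1 m,
      (Polynomial.X - Polynomial.C (((2 * (j : ℝ) - 1 - α) / 2) ^ 2))).coeff i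
      = (-1) ^ (m + i) * (∏ j ∈ Finset.Icc 1 m,
      (Polynomial.X + Polynomial.C (((2 * (j : ℝ) - 1 - α) / 2) ^ 2))).coeff i ∧
      0 ≤ (∏ j ∈ Finset.Icc 1 m,
      (Polynomial.X + Polynomial.C (((2 * (j : ℝ) - 1 - α) / 2) ^ 2))).coeff i := by
    intro m
    induction m with
    | zero =>
      intro i
      rcases i with _ | i <;> simp [Polynomial.coeff_one]
    | succ m ih =>
      intro i
      rw [Finset.prod_Icc_succ_top (by omega), Finset.prod_Icc_succ_top (by omega)]
      rcases i with _ | i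
      · simp only [mul_sub, mul_add, Polynomial.coeff_sub, Polynomial.coeff_add,
          Polynomial.coeff_mul_X_zero, Polynomial.coeff_mul_C, (ih 0).1]
        have := (ih 0).2
        refine ⟨by ring, by positivity⟩
      · simp only [mul_sub, mul_add, Polynomial.coeff_sub, Polynomial.coeff_add,
          Polynomial.coeff_mul_X, Polynomial.coeff_mul_C, (ih i).1, (ih (i + 1)).1]
        have := (ih i).2
        have := (ih (i + 1)).2
        refine ⟨by ring, by positivity⟩
  rw [coeffC, polyP_eq, ← Polynomial.expand_eq_comp_X_pow,
    Polynomial.coeff_expand_mul' (by norm_num), (key m i).1, abs_mul, abs_pow, abs_neg, abs_one,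
    one_pow, one_mul, abs_of_nonneg (key m i).2]

theorem constA_eq_abs_coeffC (m : ℕ) (α : ℝ) : constA m α = |coeffC (2 * 0) m α| := by
  rw [abs_coeffC, constA, Polynomial.coeff_zero_eq_eval_zero, Polynomial.eval_prod]
  simp

theorem constB_eq_abs_coeffC (m : ℕ) (hm : 1 ≤ m) (α : ℝ) :
    constB m α = |coeffC (2 * 1) m α| / 4 := by
  have h1 : ∀ p : Polynomial ℝ, p.coeff 1 = (Polynomial.derivative p).eval 0 := fun p => by
    rw [← Polynomial.coeff_zero_eq_eval_zero, Polynomial.coeff_derivative]; simp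
  rw [abs_coeffC, h1, Polynomial.derivative_prod_finset, Polynomial.eval_finsetSum, constB,
    Finset.mul_sum, Finset.sum_div]
  refine Finset.sum_congr rfl fun k hk => ?_
  have hc : ((Finset.Icc 1 m).erase k).card + 1 = m := by
    rw [Finset.card_erase_of_mem hk]; simp; omega
  simp only [Polynomial.derivative_add, Polynomial.derivative_X, Polynomial.derivative_C, add_zero,
    mul_one, Polynomial.eval_prod, Polynomial.eval_add, Polynomial.eval_X, Polynomial.eval_C,
    zero_add, div_pow, Finset.prod_div_distrib, Finset.prod_const]
  rw [show (2 : ℝ) ^ 2 = 4 by norm_num]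
  obtain ⟨n, hn⟩ : ∃ n, ((Finset.Icc 1 m).erase k).card = n := ⟨_, rfl⟩
  rw [hn] at hc ⊢
  subst hc
  field_simp
  ring

/-- At most one of the numbers `2j - 1 - α` vanishes, so one of the summands is positive. -/
theorem constB_pos (m : ℕ) (hm : 1 ≤ m) (α : ℝ) : 0 < constB m α := by
  refine mul_pos (by positivity) ?_
  have hnn : ∀ k ∈ Finset.Icc 1 m, 0 ≤ ∏ j ∈ (Finset.Icc 1 m).erase k, (2 * (j : ℝ) - 1 - α) ^ 2 :=
    fun k _ => Finset.prod_nonneg fun _ _ => sq_nonneg _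
  rw [Finset.sum_pos_iff_of_nonneg hnn]
  by_cases h : ∃ k ∈ Finset.Icc 1 m, 2 * (k : ℝ) - 1 - α = 0
  · obtain ⟨k, hk, hk0⟩ := h
    refine ⟨k, hk, Finset.prod_pos fun j hj => ?_⟩
    have hne : j ≠ k := Finset.ne_of_mem_erase hj
    have : 2 * (j : ℝ) - 1 - α ≠ 0 := by
      intro h0
      apply hne
      have : (j : ℝ) = k := by linarith
      exact_mod_cast this
    positivity
  · push Not at h
    refine ⟨1, by simp; omega, Finset.prod_pos fun j hj => ?_⟩
    have := h j (Finset.mem_of_mem_erase hj)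
    positivity

/-! ### Logarithmic substitution -/

/-- The substitution `x = c e^{σ t}` with `σ = ±1`, mapping `ℝ` onto `(0, ∞)`. -/
noncomputable def expCoord (c σ t : ℝ) : ℝ := c * Real.exp (σ * t)

/-- The inverse `t = σ ln (x / c)` of `expCoord`. -/
noncomputable def logCoord (c σ x : ℝ) : ℝ := σ * Real.log (x / c)

theorem expCoord_pos {c : ℝ} (hc : 0 < c) (σ t : ℝ) : 0 < expCoord c σ t := by
  unfold expCoord; positivity

theorem logCoord_expCoord {c σ : ℝ} (hc : 0 < c) (hσ : σ ^ 2 = 1) (t : ℝ) :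
    logCoord c σ (expCoord c σ t) = t := by
  rw [logCoord, expCoord, mul_div_cancel_left₀ _ hc.ne', Real.log_exp, ← mul_assoc, ← sq, hσ,
    one_mul]

theorem expCoord_logCoord {c σ x : ℝ} (hc : 0 < c) (hσ : σ ^ 2 = 1) (hx : 0 < x) :
    expCoord c σ (logCoord c σ x) = x := by
  rw [logCoord, expCoord, ← mul_assoc, ← sq, hσ, one_mul, Real.exp_log (by positivity)]
  field_simp

theorem hasDerivAt_expCoord (c σ t : ℝ) :
    HasDerivAt (expCoord c σ) (σ * expCoord c σ t) t := by
  have := (((hasDerivAt_id t).const_mul σ).exp).const_mul c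
  refine this.congr_deriv ?_
  simp only [expCoord, id]
  ring

theorem contDiff_expCoord (c σ : ℝ) : ContDiff ℝ ∞ (expCoord c σ) :=
  contDiff_const.mul (Real.contDiff_exp.comp (contDiff_const.mul contDiff_id))

theorem setLIntegral_eq_of_subset_of_eq_zero {s t : Set ℝ} (hs : MeasurableSet s)
    (ht : MeasurableSet t) (hst : s ⊆ t) {F : ℝ → ℝ≥0∞} (hF : ∀ x ∉ s, F x = 0) :
    ∫⁻ x in s, F x = ∫⁻ x in t, F x := by
  have hsupp : ∀ {r : Set ℝ}, s ⊆ r → r.indicator F = F := fun hr => by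
    rw [indicator_eq_self]
    exact fun x hx => hr (by_contra fun h => hx (hF x h))
  rw [← lintegral_indicator hs, ← lintegral_indicator ht, hsupp subset_rfl, hsupp hst]

theorem lintegral_Ioi_eq_lintegral_expCoord {c σ : ℝ} (hc : 0 < c) (hσ : σ ^ 2 = 1)
    (G : ℝ → ℝ≥0∞) :
    ∫⁻ x in Ioi 0, G x = ∫⁻ t, ENNReal.ofReal (expCoord c σ t) * G (expCoord c σ t) := by
  have him : expCoord c σ '' univ = Ioi 0 := by
    ext x
    constructor
    · rintro ⟨t, -, rfl⟩
      exact expCoord_pos hc σ t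
    · exact fun hx => ⟨_, mem_univ _, expCoord_logCoord hc hσ hx⟩
  have hinj : InjOn (expCoord c σ) univ := fun a _ b _ hab => by
    rw [← logCoord_expCoord hc hσ a, hab, logCoord_expCoord hc hσ]
  have habs : |σ| = 1 := by
    rw [← sq_abs] at hσ
    exact (pow_eq_one_iff_of_nonneg (abs_nonneg σ) two_ne_zero).1 hσ
  rw [← him, lintegral_image_eq_lintegral_abs_deriv_mul MeasurableSet.univ
    (fun x _ => (hasDerivAt_expCoord c σ x).hasDerivWithinAt) hinj, setLIntegral_univ]
  simp_rw [abs_mul, habs, one_mul, abs_of_pos (expCoord_pos hc σ _)]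

/-- The function `x^{k-s} h^{(k)}(x)` in the variable `t`, where `x = c e^{σ t}`. In this variable
`x d/dx` becomes `σ d/dt`. -/
noncomputable def eulerTransform (c σ s : ℝ) (h : ℝ → ℂ) (k : ℕ) (t : ℝ) : ℂ :=
  expCoord c σ t ^ ((k : ℝ) - s) • iteratedDeriv k h (expCoord c σ t)

theorem eulerTransform_mem {c σ s T : ℝ} {U : Set ℝ} {h : ℝ → ℂ} (hc : 0 < c) (hσ : σ ^ 2 = 1)
    (hU : U ⊆ Ioi 0) (hh : h ∈ testFunctions U) (hT : ∀ x ∈ U, T < logCoord c σ x) (k : ℕ) :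
    eulerTransform c σ s h k ∈ testFunctions (Ioi T) := by
  set g := iteratedDeriv k h
  have hg : g ∈ testFunctions U := testFunctions_iteratedDeriv hh k
  have hcont : ContinuousOn (logCoord c σ) (tsupport g) := by
    refine continuousOn_const.mul (ContinuousOn.log (continuousOn_id.div_const c) fun x hx => ?_)
    have : (0 : ℝ) < x := hU (hg.2.2 hx)
    exact (div_pos this hc).ne'
  have hK : IsCompact (logCoord c σ '' tsupport g) := hg.2.1.isCompact.image_of_continuousOn hcont
  have hsupp : Function.support (eulerTransform c σ s h k) ⊆ logCoord c σ '' tsupport g := by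
    intro t ht
    refine ⟨expCoord c σ t, ?_, logCoord_expCoord hc hσ t⟩
    by_contra hx
    apply ht
    have : g (expCoord c σ t) = 0 := image_eq_zero_of_notMem_tsupport hx
    simp only [eulerTransform]
    rw [show iteratedDeriv k h (expCoord c σ t) = 0 from this, smul_zero]
  refine ⟨?_, HasCompactSupport.of_support_subset_isCompact hK hsupp, ?_⟩
  · exact ((contDiff_expCoord c σ).rpow_const_of_ne fun t => (expCoord_pos hc σ t).ne').smul
      (hg.1.comp (contDiff_expCoord c σ))
  · refine (closure_minimal hsupp hK.isClosed).trans ?_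
    rintro _ ⟨x, hx, rfl⟩
    exact hT x (hg.2.2 hx)

/-- The recursion `u_{k+1} = (σ d/dt + (s - k)) u_k`. -/
theorem eulerTransform_succ {c σ s : ℝ} {U : Set ℝ} {h : ℝ → ℂ} (hc : 0 < c) (hσ : σ ^ 2 = 1)
    (hh : h ∈ testFunctions U) (k : ℕ) :
    eulerTransform c σ s h (k + 1) = fun t =>
      σ • deriv (eulerTransform c σ s h k) t + (s - k) • eulerTransform c σ s h k t := by
  ext1 t
  have hx := expCoord_pos hc σ t
  have h1 := hasDerivAt_expCoord c σ t
  have h2 : HasDerivAt (fun t => expCoord c σ t ^ ((k : ℝ) - s))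
      (σ * expCoord c σ t * ((k : ℝ) - s) * expCoord c σ t ^ ((k : ℝ) - s - 1)) t :=
    h1.rpow_const (Or.inl hx.ne')
  have h3 : HasDerivAt (fun t => iteratedDeriv k h (expCoord c σ t))
      ((σ * expCoord c σ t) • iteratedDeriv (k + 1) h (expCoord c σ t)) t := by
    have := (testFunctions_differentiable (testFunctions_iteratedDeriv hh k)
      (expCoord c σ t)).hasDerivAt
    rw [← iteratedDeriv_succ] at this
    exact this.scomp t h1
  have h4 := (h2.smul h3).deriv
  have h5 : deriv (eulerTransform c σ s h k) t = _ := h4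
  rw [h5]
  simp only [eulerTransform, smul_add, smul_smul, Nat.cast_add, Nat.cast_one]
  have e1 : expCoord c σ t * expCoord c σ t ^ ((k : ℝ) - s - 1)
      = expCoord c σ t ^ ((k : ℝ) - s) := by
    rw [Real.rpow_sub_one hx.ne']
    field_simp
  have e2 : expCoord c σ t ^ ((k : ℝ) + 1 - s)
      = expCoord c σ t ^ ((k : ℝ) - s) * expCoord c σ t := by
    rw [← Real.rpow_add_one hx.ne']
    ring_nf
  have e3 : σ * (σ * expCoord c σ t * ((k : ℝ) - s) * expCoord c σ t ^ ((k : ℝ) - s - 1))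
      = (k - s) * expCoord c σ t ^ ((k : ℝ) - s) := by
    rw [← e1]
    linear_combination expCoord c σ t * ((k : ℝ) - s) * expCoord c σ t ^ ((k : ℝ) - s - 1) * hσ
  have e4 : σ * (expCoord c σ t ^ ((k : ℝ) - s) * (σ * expCoord c σ t))
      = expCoord c σ t ^ ((k : ℝ) + 1 - s) := by
    rw [e2]
    linear_combination expCoord c σ t ^ ((k : ℝ) - s) * expCoord c σ t * hσ
  rw [e3, e4, add_assoc, ← add_smul, ← add_mul]
  simp

theorem lintegral_Ioi_eq_eulerTransform {c σ s β : ℝ} (hc : 0 < c) (hσ : σ ^ 2 = 1) (k : ℕ)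
    (hβ : β = 2 * k - 2 * s - 1) (W : ℝ → ℝ) (h : ℝ → ℂ) :
    ∫⁻ x in Ioi 0, ENNReal.ofReal (x ^ β * W x * ‖iteratedDeriv k h x‖ ^ 2)
      = ∫⁻ t, ENNReal.ofReal (W (expCoord c σ t) * ‖eulerTransform c σ s h k t‖ ^ 2) := by
  rw [lintegral_Ioi_eq_lintegral_expCoord hc hσ]
  refine lintegral_congr fun t => ?_
  have hx := expCoord_pos hc σ t
  rw [← ENNReal.ofReal_mul hx.le, eulerTransform, norm_smul, mul_pow, Real.norm_eq_abs, sq_abs]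
  congr 1
  have e : expCoord c σ t * expCoord c σ t ^ β = (expCoord c σ t ^ ((k : ℝ) - s)) ^ 2 := by
    rw [mul_comm, ← Real.rpow_add_one hx.ne', ← Real.rpow_natCast, ← Real.rpow_mul hx.le, hβ]
    congr 1
    push_cast
    ring
  rw [← e]
  ring

theorem ofReal_integral_norm_sq {U : Set ℝ} {φ : ℝ → ℂ} (hφ : φ ∈ testFunctions U) :
    ENNReal.ofReal (∫ t, ‖φ t‖ ^ 2) = ∫⁻ t, ENNReal.ofReal (‖φ t‖ ^ 2) :=
  ofReal_integral_eq_lintegral_ofReal (testFunctions_integrable_norm_sq hφ)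
    (Eventually.of_forall fun _ => sq_nonneg _)

/-- After the substitution with `s = (2ℓ - 1 - α) / 2`, the operator `d^ℓ/dx^ℓ` becomes
`∏ (± d/dt + (2j - 1 - α) / 2)`, whose energy is the sum of the energies of the derivatives with
the coefficients `|c_{2i}|`. -/
theorem homNormSq_eq_sum {c σ α : ℝ} {ℓ : ℕ} {U : Set ℝ} {h : ℝ → ℂ} (hc : 0 < c) (hσ : σ ^ 2 = 1)
    (hU : U ⊆ Ioi 0) (hUm : MeasurableSet U) (hh : h ∈ testFunctions U) :
    homNormSq U ℓ α h = ∑ i ∈ Finset.range (ℓ + 1), ENNReal.ofReal |coeffC (2 * i) ℓ α| *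
      ∫⁻ t, ENNReal.ofReal
        (‖iteratedDeriv i (eulerTransform c σ ((2 * ℓ - 1 - α) / 2) h 0) t‖ ^ 2) := by
  set s := (2 * (ℓ : ℝ) - 1 - α) / 2 with hs
  set u := eulerTransform c σ s h with hu
  have hmem : ∀ k, u k ∈ testFunctions univ := by
    intro k
    obtain ⟨T, hT⟩ : ∃ T, ∀ x ∈ tsupport h, T < logCoord c σ x := by
      have hcont : ContinuousOn (logCoord c σ) (tsupport h) := by
        refine continuousOn_const.mul
          (ContinuousOn.log (continuousOn_id.div_const c) fun x hx => ?_)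
        have : (0 : ℝ) < x := hU (hh.2.2 hx)
        exact (div_pos this hc).ne'
      obtain ⟨T, hT⟩ := (hh.2.1.isCompact.image_of_continuousOn hcont).bddBelow
      exact ⟨T - 1, fun x hx => by linarith [hT (mem_image_of_mem _ hx)]⟩
    exact testFunctions_mono (subset_univ _) (eulerTransform_mem (s := s) hc hσ
      (U := tsupport h) (hh.2.2.trans hU) ⟨hh.1, hh.2.1, subset_rfl⟩ hT k)
  have hP : ∏ j ∈ Finset.range ℓ, (Polynomial.X + Polynomial.C ((s - (j : ℝ)) ^ 2))
      = ∏ j ∈ Finset.Icc 1 ℓ,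
        (Polynomial.X + Polynomial.C (((2 * (j : ℝ) - 1 - α) / 2) ^ 2)) := by
    rw [← Finset.prod_range_reflect, Finset.range_eq_Ico, ← Finset.Ico_add_one_right_eq_Icc,
      ← Finset.prod_Ico_add' _ 0 ℓ 1]
    refine Finset.prod_congr rfl fun j hj => ?_
    simp only [Finset.mem_Ico] at hj
    have : ((ℓ - 1 - j : ℕ) : ℝ) = ℓ - 1 - j := by
      rw [Nat.sub_sub, Nat.cast_sub (by omega)]
      push_cast
      ring
    rw [this, hs]
    push_cast
    congr 3
    ring
  have hsum := integral_norm_sq_eq_sum_coeff hσ hmem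
    (a := fun k => s - k) (eulerTransform_succ hc hσ hh) ℓ 0
  rw [hP] at hsum
  simp only [← abs_coeffC, iteratedDeriv_zero, add_zero] at hsum
  have hE : homNormSq U ℓ α h = ∫⁻ t, ENNReal.ofReal (‖u ℓ t‖ ^ 2) := by
    have h1 := lintegral_Ioi_eq_eulerTransform (s := s) (β := α) hc hσ ℓ (by rw [hs]; ring)
      (fun _ => 1) h
    simp only [mul_one, one_mul] at h1
    rw [← h1, homNormSq]
    refine setLIntegral_eq_of_subset_of_eq_zero hUm measurableSet_Ioi hU fun x hx => ?_
    rw [testFunctions_eq_zero (testFunctions_iteratedDeriv hh ℓ) hx]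
    simp
  rw [hE, ← ofReal_integral_norm_sq (hmem ℓ), hsum,
    ENNReal.ofReal_sum_of_nonneg fun i _ => mul_nonneg (abs_nonneg _)
      (integral_nonneg fun _ => sq_nonneg _)]
  refine Finset.sum_congr rfl fun i _ => ?_
  rw [ENNReal.ofReal_mul (abs_nonneg _),
    ofReal_integral_norm_sq (testFunctions_iteratedDeriv (hmem 0) i)]

/-- A weight `t^{-2j} W'(t)` in the new variable becomes the weight `W'` in an integral of order
`j`; the power `x^{α-2ℓ}` is absorbed by the substitution. -/
theorem weightedInt_le_weightedInt {c σ α T : ℝ} {ℓ j : ℕ} {U : Set ℝ} {h : ℝ → ℂ} (hc : 0 < c)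
    (hσ : σ ^ 2 = 1) (hU : U ⊆ Ioi 0) (hUm : MeasurableSet U) (hT0 : 0 ≤ T)
    (hT : ∀ x ∈ U, T < logCoord c σ x) {W W' : ℝ → ℝ}
    (hW : ∀ x ∈ U, W x = (logCoord c σ x)⁻¹ ^ (2 * j) * W' (logCoord c σ x)) :
    weightedInt U ℓ α W h
      ≤ weightedInt (Ioi T) j 0 W' (eulerTransform c σ ((2 * ℓ - 1 - α) / 2) h 0) := by
  have h1 := lintegral_Ioi_eq_eulerTransform (s := (2 * ℓ - 1 - α) / 2) (β := α - 2 * ℓ) hc hσ 0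
    (by push_cast; ring) (U.indicator W) h
  have h2 : weightedInt U ℓ α W h = ∫⁻ x in Ioi 0,
      ENNReal.ofReal (x ^ (α - 2 * (ℓ : ℝ)) * U.indicator W x * ‖iteratedDeriv 0 h x‖ ^ 2) := by
    rw [← setLIntegral_eq_of_subset_of_eq_zero hUm measurableSet_Ioi hU
      fun x hx => by simp [indicator_of_notMem hx], weightedInt]
    refine setLIntegral_congr_fun hUm fun x hx => ?_
    simp [indicator_of_mem hx]
  rw [h2, h1, weightedInt, ← lintegral_indicator measurableSet_Ioi]
  refine lintegral_mono fun t => ?_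
  by_cases hx : expCoord c σ t ∈ U
  · have ht := hT _ hx
    have hWx := hW _ hx
    rw [logCoord_expCoord hc hσ] at ht hWx
    rw [indicator_of_mem hx, indicator_of_mem (show t ∈ Ioi T from ht), hWx]
    have ht0 : 0 < t := hT0.trans_lt ht
    apply le_of_eq
    congr 3
    rw [zero_sub, Real.rpow_neg ht0.le, inv_pow, ← Real.rpow_natCast]
    push_cast
    rfl
  · simp [indicator_of_notMem hx]

/-! ### Refinement by one more logarithm -/

/-- The unweighted Hardy–Rellich inequality of every order `j ≥ 1` on `(T, ∞)` with `N` logarithmic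
refinement terms, built from the factors `Λ 1, …, Λ N`, for test functions. -/
def LogHardy (Λ : ℕ → ℝ → ℝ) (T : ℝ) (N : ℕ) : Prop :=
  ∀ j, 1 ≤ j → ∀ h ∈ testFunctions (Ioi T),
    ENNReal.ofReal (constA j 0) * weightedInt (Ioi T) j 0 (fun _ => 1) h
      + ENNReal.ofReal (constB j 0) * ∑ k ∈ Finset.Icc 1 N,
        weightedInt (Ioi T) j 0 (fun x => ∏ p ∈ Finset.Icc 1 k, Λ p x ^ 2) h
      ≤ homNormSq (Ioi T) j 0 h

theorem homNormSq_zero_le (T : ℝ) (i : ℕ) (w : ℝ → ℂ) :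
    homNormSq (Ioi T) i 0 w ≤ ∫⁻ t, ENNReal.ofReal (‖iteratedDeriv i w t‖ ^ 2) := by
  simp only [homNormSq, Real.rpow_zero, one_mul]
  exact setLIntegral_le_lintegral _ _

theorem weightedInt_zero_le (T : ℝ) (w : ℝ → ℂ) :
    weightedInt (Ioi T) 0 0 (fun _ => 1) w ≤ ∫⁻ t, ENNReal.ofReal (‖iteratedDeriv 0 w t‖ ^ 2) := by
  simp only [weightedInt, Nat.cast_zero, mul_zero, sub_zero, Real.rpow_zero, one_mul,
    iteratedDeriv_zero]
  exact setLIntegral_le_lintegral _ _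

theorem prod_Icc_one_add_one (Λ : ℕ → ℝ → ℝ) (k : ℕ) (x : ℝ) :
    ∏ p ∈ Finset.Icc 1 (k + 1), Λ p x ^ 2
      = Λ 1 x ^ 2 * ∏ p ∈ Finset.Icc 1 k, Λ (p + 1) x ^ 2 := by
  induction k with
  | zero => simp
  | succ k ih =>
    rw [Finset.prod_Icc_succ_top (by omega), ih, Finset.prod_Icc_succ_top (by omega), mul_assoc]

theorem sum_Icc_one_add_one {M : Type*} [AddCommMonoid M] (F : ℕ → M) (N : ℕ) :
    ∑ k ∈ Finset.Icc 1 (N + 1), F k = F 1 + ∑ k ∈ Finset.Icc 1 N, F (k + 1) := by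
  induction N with
  | zero => simp
  | succ k ih =>
    rw [Finset.sum_Icc_succ_top (by omega), ih, Finset.sum_Icc_succ_top (by omega), add_assoc]

/-- In the variable `t` the first factor is `1 / t` and the remaining ones are `N` factors for
which the inequality is known. The energy of order `0` gives the term with `A(ℓ, α)`, the energy of
order `1` the terms with `B(ℓ, α)`, and the energies of order `j ≥ 2` the remaining terms. -/
theorem refinedSum_le_homNormSq {Λ Λ' : ℕ → ℝ → ℝ} {c σ α T : ℝ} {ℓ N : ℕ} {U : Set ℝ} {h : ℝ → ℂ}
    (hc : 0 < c) (hσ : σ ^ 2 = 1) (hU : U ⊆ Ioi 0) (hUm : MeasurableSet U) (hT0 : 0 ≤ T)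
    (hT : ∀ x ∈ U, T < logCoord c σ x) (hΛ1 : ∀ x ∈ U, Λ 1 x = (logCoord c σ x)⁻¹)
    (hΛ : ∀ p, 1 ≤ p → ∀ x ∈ U, Λ (p + 1) x = Λ' p (logCoord c σ x))
    (hH : LogHardy Λ' T N) (hℓ : 1 ≤ ℓ) (hh : h ∈ testFunctions U) :
    refinedSum U ℓ (N + 1) α Λ h ≤ homNormSq U ℓ α h := by
  set w := eulerTransform c σ ((2 * ℓ - 1 - α) / 2) h 0 with hw
  have hwT : w ∈ testFunctions (Ioi T) := eulerTransform_mem hc hσ hU hh hT 0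
  have hle : ∀ (j : ℕ) (W W' : ℝ → ℝ),
      (∀ x ∈ U, W x = (logCoord c σ x)⁻¹ ^ (2 * j) * W' (logCoord c σ x)) →
      weightedInt U ℓ α W h ≤ weightedInt (Ioi T) j 0 W' w := fun j W W' hW =>
    weightedInt_le_weightedInt hc hσ hU hUm hT0 hT hW
  have hprod : ∀ k, ∀ x ∈ U, ∏ p ∈ Finset.Icc 1 k, Λ (p + 1) x ^ 2
      = ∏ p ∈ Finset.Icc 1 k, Λ' p (logCoord c σ x) ^ 2 := fun k x hx =>
    Finset.prod_congr rfl fun p hp => by rw [hΛ p (Finset.mem_Icc.1 hp).1 x hx]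
  have hA : ∀ j, weightedInt U ℓ α (fun x => Λ 1 x ^ (2 * j)) h
      ≤ weightedInt (Ioi T) j 0 (fun _ => 1) w := fun j =>
    hle j _ _ fun x hx => by rw [hΛ1 x hx, mul_one]
  have hB : ∀ j k, weightedInt U ℓ α
        (fun x => Λ 1 x ^ (2 * j) * ∏ p ∈ Finset.Icc 1 k, Λ (p + 1) x ^ 2) h
      ≤ weightedInt (Ioi T) j 0 (fun x => ∏ p ∈ Finset.Icc 1 k, Λ' p x ^ 2) w := fun j k =>
    hle j _ _ fun x hx => by rw [hΛ1 x hx, hprod k x hx]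
  have hE : ∀ j, 1 ≤ j → _ := fun j hj => (hH j hj w hwT).trans (homNormSq_zero_le T j w)
  have hsplit : ∀ F : ℕ → ℝ≥0∞, ∑ i ∈ Finset.range (ℓ + 1), F i
      = F 0 + F 1 + ∑ j ∈ Finset.Icc 2 ℓ, F j := by
    intro F
    rw [Finset.range_eq_Ico, Finset.sum_eq_sum_Ico_succ_bot (by omega),
      Finset.sum_eq_sum_Ico_succ_bot (by omega), Finset.Ico_add_one_right_eq_Icc]
    simp [add_assoc]
  rw [homNormSq_eq_sum hc hσ hU hUm hh, hsplit, refinedSum, Nat.add_sub_cancel, add_assoc,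
    ← Finset.sum_add_distrib]
  refine add_le_add (add_le_add ?_ ?_) (Finset.sum_le_sum fun j hj => ?_)
  · rw [← constA_eq_abs_coeffC]
    gcongr
    exact (hle 0 _ (fun _ => 1) fun x _ => by simp).trans (weightedInt_zero_le T w)
  · refine le_trans ?_ (mul_le_mul_right (hE 1 le_rfl) _)
    have h4 : ENNReal.ofReal (constB ℓ α) = ENNReal.ofReal |coeffC (2 * 1) ℓ α| *
        ENNReal.ofReal (1 / 4) := by
      rw [← ENNReal.ofReal_mul (abs_nonneg _), constB_eq_abs_coeffC ℓ hℓ]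
      congr 1
      ring
    have hA1 : constA 1 0 = 1 / 4 := by simp [constA]; norm_num
    have hB1 : constB 1 0 = 1 / 4 := by simp [constB]
    rw [h4, hA1, hB1, mul_assoc, ← mul_add, sum_Icc_one_add_one]
    gcongr
    · simpa using hA 1
    · simpa only [prod_Icc_one_add_one] using hB 1 _
  · refine le_trans ?_ (mul_le_mul_right (hE j (by grind)) _)
    rw [ENNReal.ofReal_mul (abs_nonneg _), ENNReal.ofReal_mul (abs_nonneg _), mul_assoc, mul_assoc,
      ← mul_add]
    gcongr
    · exact hA j
    · exact hB j _

/-- The Hardy–Rellich inequality without refinement. -/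
theorem LogHardy.zero (Λ : ℕ → ℝ → ℝ) {T : ℝ} (hT : 0 ≤ T) : LogHardy Λ T 0 := by
  intro j _ h hh
  have hU : Ioi T ⊆ Ioi 0 := Ioi_subset_Ioi hT
  have hw : weightedInt (Ioi T) j 0 (fun _ => 1) h ≤ ∫⁻ t, ENNReal.ofReal
      (‖iteratedDeriv 0 (eulerTransform 1 1 ((2 * j - 1 - 0) / 2) h 0) t‖ ^ 2) := by
    have h1 := lintegral_Ioi_eq_eulerTransform (c := 1) (σ := 1) (s := (2 * j - 1 - 0) / 2)
      (β := 0 - 2 * j) one_pos (one_pow 2) 0 (by push_cast; ring) (fun _ => 1) h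
    simp only [one_mul, iteratedDeriv_zero] at h1 ⊢
    rw [← h1]
    exact lintegral_mono_set hU
  rw [homNormSq_eq_sum one_pos (one_pow 2) hU measurableSet_Ioi hh, Finset.sum_range_succ',
    ← constA_eq_abs_coeffC]
  simp only [Finset.Icc_eq_empty_of_lt zero_lt_one, Finset.sum_empty, mul_zero, add_zero]
  refine le_trans ?_ le_add_self
  gcongr

/-- The special case `α = 0`, `U = (T', ∞)` of `refinedSum_le_homNormSq`, without the terms of index
`j ≥ 2`. -/
theorem LogHardy.succ {Λ Λ' : ℕ → ℝ → ℝ} {c T T' : ℝ} {N : ℕ} (hc : 0 < c) (hT0 : 0 ≤ T)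
    (hT'0 : 0 ≤ T') (hT : ∀ x, T' < x → T < logCoord c 1 x)
    (hΛ1 : ∀ x, T' < x → Λ 1 x = (logCoord c 1 x)⁻¹)
    (hΛ : ∀ p, 1 ≤ p → ∀ x, T' < x → Λ (p + 1) x = Λ' p (logCoord c 1 x))
    (hH : LogHardy Λ' T N) : LogHardy Λ T' (N + 1) := by
  intro j hj h hh
  refine le_trans ?_ (refinedSum_le_homNormSq hc (one_pow 2) (Ioi_subset_Ioi hT'0)
    measurableSet_Ioi hT0 hT hΛ1 hΛ hH hj hh)
  rw [refinedSum, add_assoc (_ + _)]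
  exact le_self_add

/-- The definition applies the outermost logarithm last; here the innermost one is split off. -/
theorem iterLog_succ' (p : ℕ) (x : ℝ) : iterLog (p + 1) x = iterLog p (Real.log x) := by
  induction p with
  | zero => rfl
  | succ p ih => rw [iterLog, ih, iterLog]

theorem normLog_succ' (p : ℕ) (s : ℝ) : normLog (p + 1) s = normLog p (1 - Real.log s)⁻¹ := by
  induction p with
  | zero => rfl
  | succ p ih => rw [normLog, ih, normLog]

theorem iterExp_nonneg (N : ℕ) : 0 ≤ iterExp N := by
  cases N with
  | zero => exact le_rfl
  | succ N => exact (Real.exp_pos _).le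

theorem logHardy_iterLog (N : ℕ) : LogHardy (fun p x => (iterLog p x)⁻¹) (iterExp N) N := by
  induction N with
  | zero => exact LogHardy.zero _ le_rfl
  | succ N ih =>
    refine LogHardy.succ one_pos (iterExp_nonneg N) (iterExp_nonneg _) (fun x hx => ?_)
      (fun x _ => ?_) (fun p _ x _ => ?_) ih
    · have hx0 : 0 < x := (Real.exp_pos _).trans hx
      simpa [logCoord] using (Real.lt_log_iff_exp_lt hx0).2 hx
    · simp [logCoord, iterLog]
    · simp [logCoord, iterLog_succ']

/-- The choice `c = a / e` produces the summand `1` in `1 - ln (a / y)`. -/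
theorem logCoord_exp_one {y a : ℝ} (ha : 0 < a) (hy : 0 < y) :
    logCoord (a / Real.exp 1) 1 y = 1 - Real.log (a / y) := by
  rw [logCoord, Real.log_div hy.ne' (by positivity), Real.log_div ha.ne' (Real.exp_pos 1).ne',
    Real.log_div ha.ne' hy.ne', Real.log_exp]
  ring

theorem logHardy_normLog (N : ℕ) : LogHardy (fun p x => normLog p (1 / x)) 1 N := by
  induction N with
  | zero => exact LogHardy.zero _ zero_le_one
  | succ N ih =>
    have hL : ∀ x : ℝ, 1 < x → logCoord (1 / Real.exp 1) 1 x = 1 - Real.log (1 / x) := fun x hx =>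
      logCoord_exp_one one_pos (by linarith)
    refine LogHardy.succ (c := 1 / Real.exp 1) (by positivity) zero_le_one zero_le_one
      (fun x hx => ?_) (fun x hx => ?_) (fun p _ x hx => ?_) ih
    · rw [hL x hx]
      have := Real.log_pos hx
      simp [this]
    · rw [hL x hx]; rfl
    · simp only [hL x hx, normLog_succ']
      rw [one_div (1 - _)]

/-! ### The four inequalities for test functions -/

theorem refinedSum_le_of_iterLog_div {ρ γ α : ℝ} {ℓ N : ℕ} (hγ : 0 < γ) (hN : 1 ≤ N)
    (hℓ : 1 ≤ ℓ) (hργ : iterExp N * γ ≤ ρ) {h : ℝ → ℂ} (hh : h ∈ testFunctions (Ioi ρ)) :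
    refinedSum (Ioi ρ) ℓ N α (fun p x => (iterLog p (x / γ))⁻¹) h ≤ homNormSq (Ioi ρ) ℓ α h := by
  obtain ⟨N, rfl⟩ := Nat.exists_eq_add_of_le' hN
  have hρ : 0 ≤ ρ := le_trans (mul_nonneg (iterExp_nonneg _) hγ.le) hργ
  refine refinedSum_le_homNormSq hγ (one_pow 2) (Ioi_subset_Ioi hρ) measurableSet_Ioi
    (iterExp_nonneg N) (fun x hx => ?_) (fun x _ => ?_) (fun p _ x _ => ?_) (logHardy_iterLog N)
    hℓ hh
  · rw [logCoord, one_mul, Real.lt_log_iff_exp_lt (div_pos (hρ.trans_lt hx) hγ), lt_div_iff₀ hγ]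
    exact hργ.trans_lt hx
  · simp [logCoord, iterLog]
  · simp [logCoord, iterLog_succ']

theorem refinedSum_le_of_normLog_div {ρ τ α : ℝ} {ℓ N : ℕ} (hτ : 0 < τ) (hN : 1 ≤ N)
    (hℓ : 1 ≤ ℓ) (hρτ : τ ≤ ρ) {h : ℝ → ℂ} (hh : h ∈ testFunctions (Ioi ρ)) :
    refinedSum (Ioi ρ) ℓ N α (fun p x => normLog p (τ / x)) h ≤ homNormSq (Ioi ρ) ℓ α h := by
  obtain ⟨N, rfl⟩ := Nat.exists_eq_add_of_le' hN
  have hρ : 0 < ρ := hτ.trans_le hρτ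
  have hL : ∀ x ∈ Ioi ρ, logCoord (τ / Real.exp 1) 1 x = 1 - Real.log (τ / x) := fun x hx =>
    logCoord_exp_one hτ (hρ.trans hx)
  refine refinedSum_le_homNormSq (c := τ / Real.exp 1) (by positivity) (one_pow 2)
    (Ioi_subset_Ioi hρ.le) measurableSet_Ioi zero_le_one (fun x hx => ?_) (fun x hx => ?_)
    (fun p _ x hx => ?_) (logHardy_normLog N) hℓ hh
  · have hx0 : 0 < x := hρ.trans hx
    rw [hL x hx]
    have : Real.log (τ / x) < 0 := Real.log_neg (by positivity)
      ((div_lt_one hx0).2 (hρτ.trans_lt hx))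
    linarith
  · rw [hL x hx]; rfl
  · simp only [hL x hx, normLog_succ', one_div]

theorem logCoord_neg_one (γ x : ℝ) : logCoord γ (-1) x = Real.log (γ / x) := by
  rw [logCoord, ← inv_div γ x, Real.log_inv]
  ring

theorem refinedSum_le_of_iterLog_div' {ρ γ α : ℝ} {ℓ N : ℕ} (hρ : 0 < ρ) (hN : 1 ≤ N)
    (hℓ : 1 ≤ ℓ) (hργ : iterExp N * ρ ≤ γ) {h : ℝ → ℂ} (hh : h ∈ testFunctions (Ioo 0 ρ)) :
    refinedSum (Ioo 0 ρ) ℓ N α (fun p x => (iterLog p (γ / x))⁻¹) h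
      ≤ homNormSq (Ioo 0 ρ) ℓ α h := by
  obtain ⟨N, rfl⟩ := Nat.exists_eq_add_of_le' hN
  have hγ : 0 < γ := (mul_pos (Real.exp_pos _) hρ).trans_le hργ
  refine refinedSum_le_homNormSq (σ := -1) hγ (by norm_num) Ioo_subset_Ioi_self measurableSet_Ioo
    (iterExp_nonneg N) (fun x hx => ?_) (fun x _ => ?_) (fun p _ x _ => ?_) (logHardy_iterLog N)
    hℓ hh
  · rw [logCoord_neg_one, Real.lt_log_iff_exp_lt (div_pos hγ hx.1), lt_div_iff₀ hx.1]
    exact (mul_lt_mul_of_pos_left hx.2 (Real.exp_pos _)).trans_le hργ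
  · simp [logCoord_neg_one, iterLog]
  · simp [logCoord_neg_one, iterLog_succ']

theorem refinedSum_le_of_normLog_div' {ρ τ α : ℝ} {ℓ N : ℕ} (hτ : 0 < τ) (hN : 1 ≤ N)
    (hℓ : 1 ≤ ℓ) (hρτ : ρ ≤ τ) {h : ℝ → ℂ} (hh : h ∈ testFunctions (Ioo 0 ρ)) :
    refinedSum (Ioo 0 ρ) ℓ N α (fun p x => normLog p (x / τ)) h ≤ homNormSq (Ioo 0 ρ) ℓ α h := by
  obtain ⟨N, rfl⟩ := Nat.exists_eq_add_of_le' hN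
  have hL : ∀ x ∈ Ioo 0 ρ, logCoord (τ * Real.exp 1) (-1) x = 1 - Real.log (x / τ) := by
    intro x hx
    have hx0 : 0 < x := hx.1
    rw [logCoord, Real.log_div hx0.ne' (by positivity), Real.log_mul hτ.ne' (Real.exp_pos 1).ne',
      Real.log_div hx0.ne' hτ.ne', Real.log_exp]
    ring
  refine refinedSum_le_homNormSq (σ := -1) (c := τ * Real.exp 1) (by positivity) (by norm_num)
    Ioo_subset_Ioi_self measurableSet_Ioo zero_le_one (fun x hx => ?_) (fun x hx => ?_)
    (fun p _ x hx => ?_) (logHardy_normLog N) hℓ hh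
  · rw [hL x hx]
    have : Real.log (x / τ) < 0 := Real.log_neg (div_pos hx.1 hτ)
      ((div_lt_one hτ).2 (hx.2.trans_le hρτ))
    linarith
  · rw [hL x hx]; rfl
  · simp only [hL x hx, normLog_succ', one_div]

/-! ### Absolutely continuous complex functions -/

theorem AbsolutelyContinuousOnInterval.congr_on {f g : ℝ → ℂ} {a b : ℝ}
    (hf : AbsolutelyContinuousOnInterval f a b) (hfg : EqOn f g (uIcc a b)) :
    AbsolutelyContinuousOnInterval g a b := by
  rw [absolutelyContinuousOnInterval_iff] at hf ⊢
  intro ε hε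
  obtain ⟨δ, hδ, h⟩ := hf ε hε
  refine ⟨δ, hδ, fun E hE hlt => ?_⟩
  refine (Finset.sum_congr rfl fun i hi => ?_).trans_lt (h E hE hlt)
  rw [hfg (hE.1 i hi).1, hfg (hE.1 i hi).2]

theorem AbsolutelyContinuousOnInterval.comp_of_dist_le {f : ℝ → ℂ} {a b : ℝ}
    (hf : AbsolutelyContinuousOnInterval f a b) {L : ℂ → ℝ}
    (hL : ∀ z w, dist (L z) (L w) ≤ dist z w) :
    AbsolutelyContinuousOnInterval (fun x => L (f x)) a b := by
  rw [absolutelyContinuousOnInterval_iff] at hf ⊢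
  intro ε hε
  obtain ⟨δ, hδ, h⟩ := hf ε hε
  exact ⟨δ, hδ, fun E hE hlt => (Finset.sum_le_sum fun i _ => hL _ _).trans_lt (h E hE hlt)⟩

theorem AbsolutelyContinuousOnInterval.integral_deriv_eq_sub_complex {f : ℝ → ℂ} {a b : ℝ}
    (hf : AbsolutelyContinuousOnInterval f a b) :
    IntervalIntegrable (deriv f) volume a b ∧ ∫ x in a..b, deriv f x = f b - f a := by
  have hre : AbsolutelyContinuousOnInterval (fun x => (f x).re) a b := hf.comp_of_dist_le
    fun z w => by
      rw [Real.dist_eq, dist_eq_norm, ← Complex.sub_re]; exact Complex.abs_re_le_norm _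
  have him : AbsolutelyContinuousOnInterval (fun x => (f x).im) a b := hf.comp_of_dist_le
    fun z w => by
      rw [Real.dist_eq, dist_eq_norm, ← Complex.sub_im]; exact Complex.abs_im_le_norm _
  set F : ℝ → ℂ := fun x => ((deriv (fun x => (f x).re) x : ℝ) : ℂ)
    + ((deriv (fun x => (f x).im) x : ℝ) : ℂ) * Complex.I with hF
  have hae : ∀ᵐ x, x ∈ uIoc a b → deriv f x = F x := by
    filter_upwards [hf.boundedVariationOn.ae_differentiableAt_of_mem_uIcc] with x hx hxm
    have hd := (hx (uIoc_subset_uIcc hxm)).hasDerivAt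
    have h1 : HasDerivAt (fun x => (f x).re) (deriv f x).re x :=
      (Complex.reCLM.hasFDerivAt (x := f x)).comp_hasDerivAt x hd
    have h2 : HasDerivAt (fun x => (f x).im) (deriv f x).im x :=
      (Complex.imCLM.hasFDerivAt (x := f x)).comp_hasDerivAt x hd
    rw [hF]
    simp only [h1.deriv, h2.deriv, Complex.re_add_im]
  have i1 : IntervalIntegrable (fun x => ((deriv (fun x => (f x).re) x : ℝ) : ℂ)) volume a b :=
    ⟨hre.intervalIntegrable_deriv.1.ofReal, hre.intervalIntegrable_deriv.2.ofReal⟩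
  have i2 : IntervalIntegrable (fun x => ((deriv (fun x => (f x).im) x : ℝ) : ℂ) * Complex.I)
      volume a b :=
    IntervalIntegrable.mul_const
      ⟨him.intervalIntegrable_deriv.1.ofReal, him.intervalIntegrable_deriv.2.ofReal⟩ _
  constructor
  · exact (i1.add i2).congr_ae ((ae_restrict_iff' measurableSet_uIoc).2
      (hae.mono fun x hx hm => (hx hm).symm))
  · rw [intervalIntegral.integral_congr_ae hae, hF, intervalIntegral.integral_add i1 i2,
      intervalIntegral.integral_mul_const, intervalIntegral.integral_ofReal,
      intervalIntegral.integral_ofReal, hre.integral_deriv_eq_sub, him.integral_deriv_eq_sub]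
    apply Complex.ext <;> simp

/-- Cauchy–Schwarz against the constant function `1`. -/
theorem lintegral_sq_le {s : Set ℝ} {F : ℝ → ℝ≥0∞} (hF : AEMeasurable F (volume.restrict s)) :
    (∫⁻ x in s, F x) ^ 2 ≤ volume s * ∫⁻ x in s, F x ^ 2 := by
  have h := ENNReal.lintegral_mul_le_Lp_mul_Lq (volume.restrict s)
    (Real.HolderConjugate.two_two) (f := fun _ => 1) aemeasurable_const hF
  simp only [Pi.mul_apply, one_mul, ENNReal.one_rpow, lintegral_const, Measure.restrict_apply
    MeasurableSet.univ, univ_inter] at h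
  have h2 := pow_le_pow_left₀ bot_le h 2
  have e : ∀ z : ℝ≥0∞, (z ^ (1 / 2 : ℝ)) ^ 2 = z := fun z => by
    rw [← ENNReal.rpow_natCast, ← ENNReal.rpow_mul]
    norm_num
  rw [mul_pow, e, e] at h2
  simpa using h2

theorem AbsolutelyContinuousOnInterval.enorm_sub_sq_le {g : ℝ → ℂ} {x y : ℝ}
    (hg : AbsolutelyContinuousOnInterval g x y) :
    ‖g y - g x‖ₑ ^ 2 ≤ ENNReal.ofReal |y - x| * ∫⁻ t in uIoc x y, ‖deriv g t‖ₑ ^ 2 := by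
  rw [← hg.integral_deriv_eq_sub_complex.2]
  have h1 : ‖∫ t in x..y, deriv g t‖ₑ ≤ ∫⁻ t in uIoc x y, ‖deriv g t‖ₑ := by
    rw [← enorm_norm, intervalIntegral.norm_intervalIntegral_eq, enorm_norm]
    exact enorm_integral_le_lintegral_enorm _
  refine (pow_le_pow_left₀ bot_le h1 2).trans ((lintegral_sq_le
    (measurable_deriv g).enorm.aemeasurable).trans ?_)
  rw [Real.volume_uIoc]

/-! ### Intermediate derivatives -/

theorem LocACDerivs.continuousOn {U : Set ℝ} {m k : ℕ} {f : ℝ → ℂ} (hU : IsOpen U)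
    (hf : LocACDerivs U m f) (hk : k < m) : ContinuousOn (iteratedDeriv k f) U := by
  intro x hx
  obtain ⟨δ, hδ, hI⟩ := Metric.nhds_basis_closedBall.mem_iff.1 (hU.mem_nhds hx)
  rw [Real.closedBall_eq_Icc] at hI
  have hc := (hf k hk _ _ (by linarith) hI).continuousOn
  rw [uIcc_of_le (by linarith)] at hc
  exact (hc.continuousAt (Icc_mem_nhds (by linarith) (by linarith))).continuousWithinAt

/-- Below the top order the derivatives exist everywhere: `f^{(k)}` is the integral of its
derivative, which is continuous. -/
theorem LocACDerivs.hasDerivAt {U : Set ℝ} {m k : ℕ} {f : ℝ → ℂ} (hU : IsOpen U)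
    (hf : LocACDerivs U m f) (hk : k + 1 < m) {x : ℝ} (hx : x ∈ U) :
    HasDerivAt (iteratedDeriv k f) (iteratedDeriv (k + 1) f x) x := by
  obtain ⟨δ, hδ, hI⟩ := Metric.nhds_basis_closedBall.mem_iff.1 (hU.mem_nhds hx)
  rw [Real.closedBall_eq_Icc] at hI
  have hcont := hf.continuousOn hU hk
  have hac : ∀ y ∈ Icc (x - δ) (x + δ),
      AbsolutelyContinuousOnInterval (iteratedDeriv k f) (x - δ) y := fun y hy =>
    hf k (by omega) _ _ hy.1 ((Icc_subset_Icc_right hy.2).trans hI)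
  have hii := (hac x ⟨by linarith, by linarith⟩).integral_deriv_eq_sub_complex.1
  rw [← iteratedDeriv_succ] at hii
  have hint : HasDerivAt (fun y => iteratedDeriv k f (x - δ)
      + ∫ t in (x - δ)..y, iteratedDeriv (k + 1) f t) (iteratedDeriv (k + 1) f x) x :=
    (intervalIntegral.integral_hasDerivAt_right hii
      (hcont.stronglyMeasurableAtFilter hU x hx) (hcont.continuousAt (hU.mem_nhds hx))).const_add _
  refine hint.congr_of_eventuallyEq ?_
  filter_upwards [Icc_mem_nhds (show x - δ < x by linarith) (show x < x + δ by linarith)]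
    with y hy
  rw [iteratedDeriv_succ, (hac y hy).integral_deriv_eq_sub_complex.2]
  ring

theorem LocACDerivs.iteratedDeriv_sub {U : Set ℝ} {m k : ℕ} {f φ : ℝ → ℂ} (hU : IsOpen U)
    (hf : LocACDerivs U m f) (hφ : φ ∈ testFunctions U) (hk : k < m) :
    EqOn (iteratedDeriv k (f - φ)) (iteratedDeriv k f - iteratedDeriv k φ) U := by
  induction k with
  | zero => intro x _; simp
  | succ k ih =>
    intro x hx
    have h1 := (ih (by omega)).eventuallyEq_of_mem (hU.mem_nhds hx)
    have h2 := (testFunctions_differentiable (testFunctions_iteratedDeriv hφ k) x).hasDerivAt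
    rw [iteratedDeriv_succ, h1.deriv_eq, ((hf.hasDerivAt hU hk hx).sub h2).deriv, Pi.sub_apply,
      iteratedDeriv_succ (f := φ)]

/-- The top derivative, which exists only almost everywhere, is linear almost everywhere. -/
theorem LocACDerivs.iteratedDeriv_sub_ae {U : Set ℝ} {m : ℕ} {f φ : ℝ → ℂ} (hU : IsOpen U)
    (hUc : U.OrdConnected) (hf : LocACDerivs U m f) (hφ : φ ∈ testFunctions U) :
    ∀ᵐ x, x ∈ U → iteratedDeriv m (f - φ) x = iteratedDeriv m f x - iteratedDeriv m φ x := by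
  rcases m with _ | m
  · exact Eventually.of_forall fun x _ => by simp
  refine ae_of_mem_of_ae_of_mem_inter_Ioo fun a b ha hb hab => ?_
  have hac := hf m (by omega) a b hab.le (hUc.out ha hb)
  filter_upwards [hac.boundedVariationOn.ae_differentiableAt_of_mem_uIcc] with x hx hxm
  have h0 := (hx (by rw [uIcc_of_le hab.le]; exact Ioo_subset_Icc_self hxm.2)).hasDerivAt
  have h1 := (hf.iteratedDeriv_sub hU hφ (Nat.lt_succ_self m)).eventuallyEq_of_mem
    (hU.mem_nhds hxm.1)
  have h2 := (testFunctions_differentiable (testFunctions_iteratedDeriv hφ m) x).hasDerivAt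
  rw [iteratedDeriv_succ, h1.deriv_eq, (h0.sub h2).deriv, iteratedDeriv_succ, iteratedDeriv_succ]

theorem LocACDerivs.sub {U : Set ℝ} {m : ℕ} {f φ : ℝ → ℂ} (hU : IsOpen U)
    (hf : LocACDerivs U m f) (hφ : φ ∈ testFunctions U) : LocACDerivs U m (f - φ) := by
  intro k hk a b hab hI
  have h1 : AbsolutelyContinuousOnInterval (iteratedDeriv k φ) a b :=
    ((testFunctions_iteratedDeriv hφ k).1.of_le
      (by exact_mod_cast le_top)).contDiffOn.absolutelyContinuousOnInterval
  refine ((hf k hk a b hab hI).sub h1).congr_on ?_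
  rw [uIcc_of_le hab]
  exact ((hf.iteratedDeriv_sub hU hφ hk).mono hI).symm

/-! ### Intervals with a regular endpoint -/

/-- `U` is an open interval in `(0, ∞)` having `ρ > 0` as one of its endpoints. -/
structure IsIntervalWithEndpoint (U : Set ℝ) (ρ : ℝ) : Prop where
  isOpen : IsOpen U
  ordConnected : U.OrdConnected
  subset : U ⊆ Ioi 0
  pos : 0 < ρ
  neBot : (𝓝[U] ρ).NeBot
  eventually_mem : ∀ x ∈ U, ∀ᶠ y in 𝓝[U] ρ, y ∈ uIcc x ρ
  notMem : ρ ∉ U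

theorem isIntervalWithEndpoint_Ioi {ρ : ℝ} (hρ : 0 < ρ) : IsIntervalWithEndpoint (Ioi ρ) ρ where
  isOpen := isOpen_Ioi
  ordConnected := ordConnected_Ioi
  subset := Ioi_subset_Ioi hρ.le
  pos := hρ
  neBot := inferInstance
  eventually_mem x hx := by
    filter_upwards [Ioo_mem_nhdsGT (show ρ < x from hx)] with y hy
    rw [uIcc_of_ge (le_of_lt hx)]
    exact Ioo_subset_Icc_self hy
  notMem := by simp

theorem isIntervalWithEndpoint_Ioo {ρ : ℝ} (hρ : 0 < ρ) :
    IsIntervalWithEndpoint (Ioo 0 ρ) ρ where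
  isOpen := isOpen_Ioo
  ordConnected := ordConnected_Ioo
  subset := Ioo_subset_Ioi_self
  pos := hρ
  neBot := by rw [nhdsWithin_Ioo_eq_nhdsLT hρ]; infer_instance
  eventually_mem x hx := by
    rw [nhdsWithin_Ioo_eq_nhdsLT hρ]
    filter_upwards [Ioo_mem_nhdsLT hx.2] with y hy
    rw [uIcc_of_le hx.2.le]
    exact Ioo_subset_Icc_self hy
  notMem := by simp

/-- On the part of `U` between `x₀` and the endpoint `ρ`, the weight `x^α` is bounded below. -/
theorem IsIntervalWithEndpoint.exists_lintegral_le {U : Set ℝ} {ρ x₀ : ℝ}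
    (hU : IsIntervalWithEndpoint U ρ) (hx₀ : x₀ ∈ U) (α : ℝ) :
    ∃ C : ℝ≥0∞, C ≠ ⊤ ∧ ∀ (k : ℕ) (g : ℝ → ℂ),
      ∫⁻ x in U ∩ uIcc x₀ ρ, ‖iteratedDeriv k g x‖ₑ ^ 2 ≤ C * homNormSq U k α g := by
  have hpos : ∀ x ∈ uIcc x₀ ρ, 0 < x := fun x hx =>
    lt_of_lt_of_le (lt_min (hU.subset hx₀) hU.pos) hx.1
  obtain ⟨z, hz, hmin⟩ := (isCompact_uIcc (a := x₀) (b := ρ)).exists_isMinOn ⟨x₀, left_mem_uIcc⟩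
    (f := fun x => x ^ α) (ContinuousOn.rpow_const continuousOn_id
      fun x hx => Or.inl (hpos x hx).ne')
  have hc : 0 < z ^ α := Real.rpow_pos_of_pos (hpos z hz) α
  refine ⟨ENNReal.ofReal (z ^ α)⁻¹, ENNReal.ofReal_ne_top, fun k g => ?_⟩
  rw [homNormSq, ← lintegral_const_mul' _ _ ENNReal.ofReal_ne_top]
  refine (setLIntegral_mono' (hU.isOpen.measurableSet.inter measurableSet_uIcc)
    fun x hx => ?_).trans (lintegral_mono_set inter_subset_left)
  rw [← ofReal_norm, ← ENNReal.ofReal_pow (norm_nonneg _), ← ENNReal.ofReal_mul (by positivity)]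
  apply ENNReal.ofReal_le_ofReal
  have h1 : z ^ α ≤ x ^ α := hmin hx.2
  rw [← mul_assoc]
  refine le_mul_of_one_le_left (sq_nonneg _) ?_
  rw [inv_mul_eq_div, one_le_div hc]
  exact h1

/-- As `G` vanishes at `ρ`, `G(x)` is the integral of its derivative from `ρ` to `x`, and
Cauchy–Schwarz applies. -/
theorem IsIntervalWithEndpoint.enorm_sq_le {U : Set ℝ} {ρ x₀ : ℝ}
    (hU : IsIntervalWithEndpoint U ρ) {G : ℝ → ℂ}
    (hG : ∀ a b : ℝ, a ≤ b → Icc a b ⊆ U → AbsolutelyContinuousOnInterval G a b)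
    (hlim : Tendsto G (𝓝[U] ρ) (𝓝 0)) {x : ℝ} (hx : x ∈ U ∩ uIcc x₀ ρ) :
    ‖G x‖ₑ ^ 2 ≤ ENNReal.ofReal |ρ - x₀| * ∫⁻ t in U ∩ uIcc x₀ ρ, ‖deriv G t‖ₑ ^ 2 := by
  have := hU.neBot
  have ht : Tendsto (fun y => ‖G x - G y‖ₑ ^ 2) (𝓝[U] ρ) (𝓝 (‖G x - 0‖ₑ ^ 2)) :=
    (ENNReal.continuous_pow 2).continuousAt.tendsto.comp
      ((continuous_enorm.tendsto _).comp (tendsto_const_nhds.sub hlim))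
  rw [sub_zero] at ht
  refine le_of_tendsto ht ?_
  filter_upwards [hU.eventually_mem x hx.1, self_mem_nhdsWithin] with y hy hyU
  have hac : AbsolutelyContinuousOnInterval G y x := by
    rcases le_total x y with h | h
    · exact (hG x y h (hU.ordConnected.out hx.1 hyU)).symm
    · exact hG y x h (hU.ordConnected.out hyU hx.1)
  have hyK : y ∈ uIcc x₀ ρ := uIcc_subset_uIcc hx.2 right_mem_uIcc hy
  refine hac.enorm_sub_sq_le.trans ?_
  gcongr ENNReal.ofReal ?_ * ?_
  · rw [abs_sub_comm ρ x₀]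
    exact abs_sub_le_of_uIcc_subset_uIcc (uIcc_subset_uIcc hyK hx.2) |>.trans (by
      rw [abs_sub_comm])
  · refine lintegral_mono_set fun t ht => ?_
    have ht' := uIoc_subset_uIcc ht
    exact ⟨hU.ordConnected.uIcc_subset hyU hx.1 ht', uIcc_subset_uIcc hyK hx.2 ht'⟩

/-- A function vanishing at `ρ` together with its derivatives of order less than `m` is controlled
pointwise by the homogeneous norm. -/
theorem IsIntervalWithEndpoint.exists_enorm_sq_le_homNormSq {U : Set ℝ} {ρ x₀ : ℝ}
    (hU : IsIntervalWithEndpoint U ρ) (hx₀ : x₀ ∈ U) (α : ℝ) {m k : ℕ} (hk : k < m) :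
    ∃ C : ℝ≥0∞, C ≠ ⊤ ∧ ∀ g : ℝ → ℂ, LocACDerivs U m g →
      (∀ i < m, Tendsto (iteratedDeriv i g) (𝓝[U] ρ) (𝓝 0)) →
      ‖iteratedDeriv k g x₀‖ₑ ^ 2 ≤ C * homNormSq U m α g := by
  obtain ⟨C, hC, hCle⟩ := hU.exists_lintegral_le hx₀ α
  set D := ENNReal.ofReal |ρ - x₀| with hD
  have hDtop : D ≠ ⊤ := ENNReal.ofReal_ne_top
  refine ⟨D ^ (2 * (m - 1 - k) + 1) * C, ENNReal.mul_ne_top (ENNReal.pow_ne_top hDtop) hC,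
    fun g hg hlim => ?_⟩
  have hvol : volume (U ∩ uIcc x₀ ρ) ≤ D := by
    refine (measure_mono inter_subset_right).trans ?_
    rw [uIcc, Real.volume_Icc, max_sub_min_eq_abs, hD]
  have key : ∀ n k, k + n + 1 = m → ∀ x ∈ U ∩ uIcc x₀ ρ, ‖iteratedDeriv k g x‖ₑ ^ 2
      ≤ D ^ (2 * n + 1) * ∫⁻ t in U ∩ uIcc x₀ ρ, ‖iteratedDeriv m g t‖ₑ ^ 2 := by
    intro n
    induction n with
    | zero =>
      intro k hk x hx
      have := hU.enorm_sq_le (hg k (by omega)) (hlim k (by omega)) hx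
      rw [← iteratedDeriv_succ, show k + 1 = m by omega] at this
      simpa using this
    | succ n ih =>
      intro k hk x hx
      refine (hU.enorm_sq_le (hg k (by omega)) (hlim k (by omega)) hx).trans ?_
      rw [← iteratedDeriv_succ]
      have h1 := setLIntegral_mono' (μ := volume) (hU.isOpen.measurableSet.inter measurableSet_uIcc)
        (ih (k + 1) (by omega))
      rw [setLIntegral_const] at h1
      calc _ ≤ D * (D ^ (2 * n + 1) * (∫⁻ t in U ∩ uIcc x₀ ρ, ‖iteratedDeriv m g t‖ₑ ^ 2) * D) := by
            gcongr
            exact h1.trans (by gcongr)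
        _ = _ := by ring
  refine (key (m - 1 - k) k (by omega) x₀ ⟨hx₀, left_mem_uIcc⟩).trans ?_
  rw [mul_assoc]
  gcongr
  exact hCle m g

/-! ### Passage from test functions to their closure -/

theorem measurable_iteratedDeriv {m : ℕ} (hm : 1 ≤ m) (f : ℝ → ℂ) :
    Measurable (iteratedDeriv m f) := by
  obtain ⟨m, rfl⟩ := Nat.exists_eq_add_of_le' hm
  rw [iteratedDeriv_succ]
  exact measurable_deriv _

/-- `|||φ|||² ≤ (1 + δ) |||f|||² + (1 + 1/δ) |||f - φ|||²`. -/
theorem homNormSq_le_add {U : Set ℝ} {ρ α δ : ℝ} {m : ℕ} {f φ : ℝ → ℂ}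
    (hU : IsIntervalWithEndpoint U ρ) (hm : 1 ≤ m) (hf : LocACDerivs U m f)
    (hφ : φ ∈ testFunctions U) (hδ : 0 < δ) :
    homNormSq U m α φ ≤ ENNReal.ofReal (1 + δ) * homNormSq U m α f
      + ENNReal.ofReal (1 + δ⁻¹) * homNormSq U m α (f - φ) := by
  have hmeas : ∀ g : ℝ → ℂ,
      Measurable fun x => ENNReal.ofReal (x ^ α * ‖iteratedDeriv m g x‖ ^ 2) := fun g =>
    ((measurable_id.pow_const α).mul
      ((measurable_iteratedDeriv hm g).norm.pow_const 2)).ennreal_ofReal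
  simp only [homNormSq]
  rw [← lintegral_const_mul _ (hmeas f), ← lintegral_const_mul _ (hmeas (f - φ)),
    ← lintegral_add_left ((hmeas f).const_mul _)]
  refine lintegral_mono_ae ((ae_restrict_iff' hU.isOpen.measurableSet).2 ?_)
  filter_upwards [hf.iteratedDeriv_sub_ae hU.isOpen hU.ordConnected hφ] with x hx hxU
  have hxα : 0 ≤ x ^ α := Real.rpow_nonneg (le_of_lt (hU.subset hxU)) α
  rw [← ENNReal.ofReal_mul (by positivity), ← ENNReal.ofReal_mul (by positivity),
    ← ENNReal.ofReal_add (by positivity) (by positivity), hx hxU]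
  apply ENNReal.ofReal_le_ofReal
  set a := iteratedDeriv m f x
  set b := iteratedDeriv m φ x
  have h1 : ‖b‖ ≤ ‖a‖ + ‖a - b‖ := by
    have := norm_sub_le a (a - b)
    rwa [sub_sub_cancel] at this
  have h2 : 2 * (‖a‖ * ‖a - b‖) ≤ δ * ‖a‖ ^ 2 + δ⁻¹ * ‖a - b‖ ^ 2 := by
    have h3 := mul_nonneg (inv_pos.2 hδ).le (sq_nonneg (δ * ‖a‖ - ‖a - b‖))
    have h4 : δ⁻¹ * (δ * ‖a‖ - ‖a - b‖) ^ 2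
        = δ * ‖a‖ ^ 2 + δ⁻¹ * ‖a - b‖ ^ 2 - 2 * (‖a‖ * ‖a - b‖) := by
      field_simp
      ring
    linarith
  have h5 : ‖b‖ ^ 2 ≤ (1 + δ) * ‖a‖ ^ 2 + (1 + δ⁻¹) * ‖a - b‖ ^ 2 := by
    have := pow_le_pow_left₀ (norm_nonneg b) h1 2
    nlinarith
  calc x ^ α * ‖b‖ ^ 2 ≤ x ^ α * ((1 + δ) * ‖a‖ ^ 2 + (1 + δ⁻¹) * ‖a - b‖ ^ 2) := by gcongr
    _ = _ := by ring

theorem LocACDerivs.tendsto_iteratedDeriv_sub {U : Set ℝ} {ρ : ℝ} {m k : ℕ} {f φ : ℝ → ℂ}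
    (hU : IsIntervalWithEndpoint U ρ) (hf : LocACDerivs U m f) (hφ : φ ∈ testFunctions U)
    (hk : k < m) (hlim : Tendsto (iteratedDeriv k f) (𝓝[U] ρ) (𝓝 0)) :
    Tendsto (iteratedDeriv k (f - φ)) (𝓝[U] ρ) (𝓝 0) := by
  have hφk := testFunctions_iteratedDeriv hφ k
  have h1 : Tendsto (iteratedDeriv k φ) (𝓝[U] ρ) (𝓝 (iteratedDeriv k φ ρ)) :=
    hφk.1.continuous.continuousAt.tendsto.mono_left nhdsWithin_le_nhds
  rw [testFunctions_eq_zero hφk hU.notMem] at h1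
  have h2 := hlim.sub h1
  rw [sub_zero] at h2
  refine h2.congr' ?_
  filter_upwards [self_mem_nhdsWithin] with x hx
  exact (hf.iteratedDeriv_sub hU.isOpen hφ hk hx).symm

theorem homSobolevZero_sub {U : Set ℝ} {ρ α : ℝ} {m : ℕ} {f φ : ℝ → ℂ}
    (hU : IsIntervalWithEndpoint U ρ) (hf : f ∈ homSobolevZero U ρ m α)
    (hφ : φ ∈ testFunctions U) (hfin : homNormSq U m α (f - φ) < ⊤) :
    f - φ ∈ homSobolevZero U ρ m α := by
  refine ⟨⟨hf.1.1.sub hU.isOpen hφ, fun k hk => hf.1.1.tendsto_iteratedDeriv_sub hU hφ hk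
    (hf.1.2.1 k hk), hfin⟩, fun ε hε => ?_⟩
  obtain ⟨ψ, hψ, hlt⟩ := hf.2 ε hε
  exact ⟨ψ - φ, testFunctions_sub hψ hφ, by rwa [sub_sub_sub_cancel_right]⟩

/-- A bound of a weighted `L²` norm of `φ^{(k)}` by the homogeneous norm extends from test functions
to their closure: by the boundary condition the approximating derivatives converge pointwise, and
Fatou's lemma applies. -/
theorem lintegral_le_homNormSq_of_testFunctions {U : Set ℝ} {ρ α : ℝ} {m k : ℕ} {f : ℝ → ℂ}
    {w : ℝ → ℝ≥0∞} (hU : IsIntervalWithEndpoint U ρ) (hk : k < m) (hw : Measurable w)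
    (hw_le : ∀ φ ∈ testFunctions U,
      ∫⁻ x in U, w x * ‖iteratedDeriv k φ x‖ₑ ^ 2 ≤ homNormSq U m α φ)
    (hf : f ∈ homSobolevZero U ρ m α) :
    ∫⁻ x in U, w x * ‖iteratedDeriv k f x‖ₑ ^ 2 ≤ homNormSq U m α f := by
  have hpos : ∀ n : ℕ, (0 : ℝ≥0∞) < ((n : ℝ≥0∞) + 1)⁻¹ := fun n => by simp
  choose φ hφ hlt using fun n : ℕ => hf.2 _ (hpos n)
  have hinv : Tendsto (fun n : ℕ => ((n : ℝ≥0∞) + 1)⁻¹) atTop (𝓝 0) := by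
    have := (tendsto_add_atTop_iff_nat 1).2 ENNReal.tendsto_inv_nat_nhds_zero
    simpa using this
  have hpt : ∀ x ∈ U, Tendsto (fun n => iteratedDeriv k (φ n) x) atTop
      (𝓝 (iteratedDeriv k f x)) := by
    intro x hx
    obtain ⟨C, hC, hle⟩ := hU.exists_enorm_sq_le_homNormSq hx α hk
    have h1 : Tendsto (fun n => ‖iteratedDeriv k f x - iteratedDeriv k (φ n) x‖ₑ ^ 2) atTop
        (𝓝 0) := by
      have h0 := ENNReal.Tendsto.const_mul hinv (a := C) (Or.inr hC)
      rw [mul_zero] at h0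
      refine tendsto_of_tendsto_of_tendsto_of_le_of_le tendsto_const_nhds h0
        (fun _ => bot_le) fun n => ?_
      have h2 := hle (f - φ n) (hf.1.1.sub hU.isOpen (hφ n)) fun i hi =>
        hf.1.1.tendsto_iteratedDeriv_sub hU (hφ n) hi (hf.1.2.1 i hi)
      rw [hf.1.1.iteratedDeriv_sub hU.isOpen (hφ n) hk hx] at h2
      exact h2.trans (by gcongr; exact (hlt n).le)
    have h3 : Tendsto (fun n => ‖iteratedDeriv k f x - iteratedDeriv k (φ n) x‖ ^ 2) atTop
        (𝓝 0) := by
      have := (ENNReal.tendsto_toReal ENNReal.zero_ne_top).comp h1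
      simpa [Function.comp_def] using this
    have h4 : Tendsto (fun n => ‖iteratedDeriv k f x - iteratedDeriv k (φ n) x‖) atTop (𝓝 0) := by
      have := h3.sqrt
      simpa using this
    have h5 := tendsto_zero_iff_norm_tendsto_zero.2 h4
    have h6 := (tendsto_const_nhds (x := iteratedDeriv k f x)).sub h5
    simpa using h6
  have hfatou : ∫⁻ x in U, w x * ‖iteratedDeriv k f x‖ₑ ^ 2
      ≤ liminf (fun n => homNormSq U m α (φ n)) atTop := by
    calc _ ≤ ∫⁻ x in U, liminf (fun n => w x * ‖iteratedDeriv k (φ n) x‖ₑ ^ 2) atTop := by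
          refine setLIntegral_mono' hU.isOpen.measurableSet fun x hx => ?_
          have h1 : Tendsto (fun n => ‖iteratedDeriv k (φ n) x‖ₑ ^ 2) atTop
              (𝓝 (‖iteratedDeriv k f x‖ₑ ^ 2)) :=
            (ENNReal.continuous_pow 2).continuousAt.tendsto.comp
              ((continuous_enorm.tendsto _).comp (hpt x hx))
          rw [← h1.liminf_eq]
          exact ENNReal.le_liminf_mul (u := fun _ => w x) |>.trans' (by simp)
      _ ≤ liminf (fun n => ∫⁻ x in U, w x * ‖iteratedDeriv k (φ n) x‖ₑ ^ 2) atTop :=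
          lintegral_liminf_le fun n => hw.mul
            ((testFunctions_iteratedDeriv (hφ n) k).1.continuous.measurable.enorm.pow_const 2)
      _ ≤ _ := liminf_le_liminf (Eventually.of_forall fun n => hw_le _ (hφ n))
  -- The norms of `φ n` tend to that of `f`; this is used up to a factor `1 + δ`, with `δ → 0`.
  have hδ : ∀ δ : ℝ, 0 < δ → ∫⁻ x in U, w x * ‖iteratedDeriv k f x‖ₑ ^ 2
      ≤ ENNReal.ofReal (1 + δ) * homNormSq U m α f := by
    intro δ hδ
    have h0 := ENNReal.Tendsto.const_mul hinv (a := ENNReal.ofReal (1 + δ⁻¹))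
      (Or.inr ENNReal.ofReal_ne_top)
    have h1 := h0.const_add (ENNReal.ofReal (1 + δ) * homNormSq U m α f)
    rw [mul_zero, add_zero] at h1
    rw [← h1.liminf_eq]
    refine hfatou.trans (liminf_le_liminf (Eventually.of_forall fun n => ?_))
    refine (homNormSq_le_add hU (by omega) hf.1.1 (hφ n) hδ).trans ?_
    gcongr
    exact (hlt n).le
  have hlim : Tendsto (fun δ : ℝ => ENNReal.ofReal (1 + δ) * homNormSq U m α f) (𝓝[>] 0)
      (𝓝 (ENNReal.ofReal (1 + 0) * homNormSq U m α f)) := by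
    refine ENNReal.Tendsto.mul_const (ENNReal.tendsto_ofReal ?_) (Or.inr hf.1.2.2.ne)
    exact (tendsto_const_nhds.add tendsto_id).mono_left nhdsWithin_le_nhds
  rw [add_zero, ENNReal.ofReal_one, one_mul] at hlim
  refine ge_of_tendsto hlim ?_
  filter_upwards [self_mem_nhdsWithin] with δ hδ0
  exact hδ δ hδ0

/-! ### The right-hand side as a weighted `L²` norm -/

/-- `Q` is the square of an `L²(U)` norm with a measurable weight. -/
def IsWeightedNormSq (U : Set ℝ) (Q : (ℝ → ℂ) → ℝ≥0∞) : Prop :=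
  ∃ w : ℝ → ℝ≥0∞, Measurable w ∧ ∀ h : ℝ → ℂ, AEMeasurable h (volume.restrict U) →
    Q h = ∫⁻ x in U, w x * ‖h x‖ₑ ^ 2

theorem IsWeightedNormSq.add {U : Set ℝ} {Q R : (ℝ → ℂ) → ℝ≥0∞} (hQ : IsWeightedNormSq U Q)
    (hR : IsWeightedNormSq U R) : IsWeightedNormSq U fun h => Q h + R h := by
  obtain ⟨v, hv, hQ⟩ := hQ
  obtain ⟨w, hw, hR⟩ := hR
  refine ⟨v + w, hv.add hw, fun h hh => ?_⟩
  simp only [hQ h hh, hR h hh, Pi.add_apply, add_mul]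
  exact (lintegral_add_left' (hv.aemeasurable.mul (hh.enorm.pow_const 2)) _).symm

theorem IsWeightedNormSq.const_mul {U : Set ℝ} {Q : (ℝ → ℂ) → ℝ≥0∞} (hQ : IsWeightedNormSq U Q)
    (c : ℝ≥0∞) : IsWeightedNormSq U fun h => c * Q h := by
  obtain ⟨w, hw, hQ⟩ := hQ
  refine ⟨fun x => c * w x, hw.const_mul c, fun h hh => ?_⟩
  simp only [hQ h hh, mul_assoc]
  exact (lintegral_const_mul'' _ (hw.aemeasurable.mul (hh.enorm.pow_const 2))).symm

theorem IsWeightedNormSq.sum {U : Set ℝ} {ι : Type*} {Q : ι → (ℝ → ℂ) → ℝ≥0∞} (s : Finset ι)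
    (hQ : ∀ i ∈ s, IsWeightedNormSq U (Q i)) : IsWeightedNormSq U fun h => ∑ i ∈ s, Q i h := by
  classical
  induction s using Finset.induction_on with
  | empty => exact ⟨0, measurable_const, fun h _ => by simp⟩
  | insert i s hi ih =>
    simp only [Finset.sum_insert hi]
    exact (hQ i (Finset.mem_insert_self i s)).add
      (ih fun j hj => hQ j (Finset.mem_insert_of_mem hj))

theorem isWeightedNormSq_weightedInt (U : Set ℝ) (ℓ : ℕ) (α : ℝ) {W : ℝ → ℝ} (hW : Measurable W) :
    IsWeightedNormSq U (weightedInt U ℓ α W) := by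
  refine ⟨fun x => ENNReal.ofReal (x ^ (α - 2 * (ℓ : ℝ)) * W x),
    ((measurable_id.pow_const _).mul hW).ennreal_ofReal, fun h _ => ?_⟩
  refine lintegral_congr fun x => ?_
  rw [ENNReal.ofReal_mul' (sq_nonneg _), ENNReal.ofReal_pow (norm_nonneg _), ofReal_norm]

theorem isWeightedNormSq_refinedSum (U : Set ℝ) (ℓ N : ℕ) (α : ℝ) {Λ : ℕ → ℝ → ℝ}
    (hΛ : ∀ p, Measurable (Λ p)) : IsWeightedNormSq U (refinedSum U ℓ N α Λ) := by
  have hprod : ∀ (k q : ℕ), Measurable fun x => ∏ p ∈ Finset.Icc 1 k, Λ (p + q) x ^ 2 :=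
    fun k q => Finset.measurable_fun_prod _ fun p _ => (hΛ (p + q)).pow_const 2
  have hpow : ∀ j, Measurable fun x => Λ 1 x ^ (2 * j) := fun j => (hΛ 1).pow_const _
  have hI : ∀ {W : ℝ → ℝ}, Measurable W → _ := fun hW => isWeightedNormSq_weightedInt U ℓ α hW
  exact ((((hI measurable_const).const_mul _).add ((IsWeightedNormSq.sum _ fun k _ =>
    hI (hprod k 0)).const_mul _)).add (IsWeightedNormSq.sum _ fun j _ =>
      (hI (hpow j)).const_mul _)).add (IsWeightedNormSq.sum _ fun j _ =>
      (IsWeightedNormSq.sum _ fun k _ => hI ((hpow j).mul (hprod k 1))).const_mul _)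

theorem homNormSq_iteratedDeriv (U : Set ℝ) {ℓ m : ℕ} (hℓm : ℓ ≤ m) (α : ℝ) (f : ℝ → ℂ) :
    homNormSq U ℓ α (iteratedDeriv (m - ℓ) f) = homNormSq U m α f := by
  simp only [homNormSq, iteratedDeriv_eq_iterate, ← Function.iterate_add_apply,
    Nat.add_sub_cancel' hℓm]

theorem refinedSum_le_of_testFunctions {U : Set ℝ} {ρ α : ℝ} {ℓ m N : ℕ} {Λ : ℕ → ℝ → ℝ}
    (hU : IsIntervalWithEndpoint U ρ) (hℓ : 1 ≤ ℓ) (hℓm : ℓ ≤ m) (hΛ : ∀ p, Measurable (Λ p))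
    (h : ∀ φ ∈ testFunctions U, refinedSum U ℓ N α Λ φ ≤ homNormSq U ℓ α φ)
    {f : ℝ → ℂ} (hf : f ∈ homSobolevZero U ρ m α) :
    refinedSum U ℓ N α Λ (iteratedDeriv (m - ℓ) f) ≤ homNormSq U m α f := by
  obtain ⟨w, hw, hQ⟩ := isWeightedNormSq_refinedSum U ℓ N α hΛ
  have hk : m - ℓ < m := by omega
  rw [hQ _ ((hf.1.1.continuousOn hU.isOpen hk).aemeasurable hU.isOpen.measurableSet)]
  refine lintegral_le_homNormSq_of_testFunctions hU hk hw (fun φ hφ => ?_) hf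
  have hφk := testFunctions_iteratedDeriv hφ (m - ℓ)
  rw [← hQ _ hφk.1.continuous.aemeasurable, ← homNormSq_iteratedDeriv U hℓm]
  exact h _ hφk

theorem measurable_iterLog (p : ℕ) : Measurable (iterLog p) := by
  induction p with
  | zero => exact measurable_id
  | succ p ih => exact Real.measurable_log.comp ih

theorem measurable_normLog (p : ℕ) : Measurable (normLog p) := by
  induction p with
  | zero => exact measurable_id
  | succ p ih => exact ((Real.measurable_log.comp ih).const_sub 1).inv

/-! ### The homogeneous and the inhomogeneous space on `(0, ρ)` -/

/-- The logarithmic term dominates a positive multiple of `x^α`, as `y (1 - ln y) ≤ 1` for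
`0 < y < 1`. -/
theorem exists_homNormSq_le_of_lt {ρ α : ℝ} (hρ : 0 < ρ) {k m : ℕ} (hk : k < m) :
    ∃ C : ℝ≥0∞, C ≠ ⊤ ∧ ∀ f ∈ homSobolevZero (Ioo 0 ρ) ρ m α,
      homNormSq (Ioo 0 ρ) k α f ≤ C * homNormSq (Ioo 0 ρ) m α f := by
  -- The case `N = 1`, `τ = ρ` of the inequality for test functions is applied with `ℓ = m - k`.
  obtain ⟨ℓ, rfl⟩ : ∃ ℓ, m = k + ℓ := ⟨m - k, by omega⟩
  have hℓ : 1 ≤ ℓ := by omega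
  have hB := constB_pos ℓ hℓ α
  set c := constB ℓ α * (ρ ^ (2 * ℓ))⁻¹ with hc
  have hc0 : 0 < c := by positivity
  refine ⟨ENNReal.ofReal c⁻¹, ENNReal.ofReal_ne_top, fun f hf => ?_⟩
  have hpt : ∀ x ∈ Ioo 0 ρ, c * x ^ α
      ≤ constB ℓ α * (x ^ (α - 2 * (ℓ : ℝ)) * normLog 1 (x / ρ) ^ 2) := by
    intro x hx
    have hx0 : 0 < x := hx.1
    have hy0 : 0 < x / ρ := div_pos hx0 hρ
    have hy1 : x / ρ < 1 := (div_lt_one hρ).2 hx.2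
    have hlog := Real.log_neg hy0 hy1
    have hL : x / ρ ≤ normLog 1 (x / ρ) := by
      have h1 := Real.one_sub_inv_le_log_of_pos hy0
      change x / ρ ≤ (1 - Real.log (x / ρ))⁻¹
      rw [le_inv_comm₀ hy0 (by linarith)]
      linarith
    have h2 : (x / ρ) ^ (2 * ℓ) ≤ normLog 1 (x / ρ) ^ 2 :=
      (pow_le_pow_of_le_one hy0.le hy1.le (show 2 ≤ 2 * ℓ by omega)).trans
        (pow_le_pow_left₀ hy0.le hL 2)
    have h3 : x ^ (α - 2 * (ℓ : ℝ)) * x ^ (2 * ℓ) = x ^ α := by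
      rw [← Real.rpow_natCast, ← Real.rpow_add hx0]
      push_cast
      ring_nf
    have h4 : (ρ ^ (2 * ℓ))⁻¹ * x ^ α = x ^ (α - 2 * (ℓ : ℝ)) * (x / ρ) ^ (2 * ℓ) := by
      rw [← h3, div_pow]
      ring
    rw [hc, mul_assoc, h4]
    have h5 := Real.rpow_nonneg hx0.le (α - 2 * (ℓ : ℝ))
    gcongr
  have hform : ∀ g : ℝ → ℂ, ENNReal.ofReal c * homNormSq (Ioo 0 ρ) k α g
      = ∫⁻ x in Ioo 0 ρ, ENNReal.ofReal (c * x ^ α) * ‖iteratedDeriv k g x‖ₑ ^ 2 := by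
    intro g
    rw [homNormSq, ← lintegral_const_mul' _ _ ENNReal.ofReal_ne_top]
    refine lintegral_congr fun x => ?_
    rw [ENNReal.ofReal_mul' (sq_nonneg _), ENNReal.ofReal_mul hc0.le,
      ENNReal.ofReal_pow (norm_nonneg _), ofReal_norm, mul_assoc]
  have key : ENNReal.ofReal c * homNormSq (Ioo 0 ρ) k α f ≤ homNormSq (Ioo 0 ρ) (k + ℓ) α f := by
    rw [hform]
    refine lintegral_le_homNormSq_of_testFunctions (isIntervalWithEndpoint_Ioo hρ) hk
      ((measurable_id.pow_const α).const_mul c).ennreal_ofReal (fun φ hφ => ?_) hf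
    have hφk := testFunctions_iteratedDeriv hφ k
    have h1 := refinedSum_le_of_normLog_div' (α := α) (N := 1) hρ le_rfl hℓ le_rfl hφk
    have h2 := homNormSq_iteratedDeriv (Ioo 0 ρ) (show ℓ ≤ k + ℓ by omega) α φ
    rw [Nat.add_sub_cancel] at h2
    rw [h2] at h1
    refine le_trans ?_ h1
    rw [refinedSum, add_assoc (_ + _)]
    refine le_trans (le_trans ?_ le_add_self) le_self_add
    simp only [Finset.Icc_self, Finset.sum_singleton, Finset.prod_singleton]
    rw [weightedInt, ← lintegral_const_mul' _ _ ENNReal.ofReal_ne_top]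
    refine setLIntegral_mono' measurableSet_Ioo fun x hx => ?_
    rw [← ofReal_norm, ← ENNReal.ofReal_pow (norm_nonneg _), ← ENNReal.ofReal_mul' (sq_nonneg _),
      ← ENNReal.ofReal_mul hB.le]
    apply ENNReal.ofReal_le_ofReal
    rw [← mul_assoc (constB ℓ α)]
    exact mul_le_mul_of_nonneg_right (hpt x hx) (sq_nonneg _)
  calc homNormSq (Ioo 0 ρ) k α f
      = ENNReal.ofReal c⁻¹ * (ENNReal.ofReal c * homNormSq (Ioo 0 ρ) k α f) := by
        rw [← mul_assoc, ← ENNReal.ofReal_mul (by positivity), inv_mul_cancel₀ hc0.ne',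
          ENNReal.ofReal_one, one_mul]
    _ ≤ _ := by gcongr

theorem exists_sobNormSq_le {ρ : ℝ} (α : ℝ) (hρ : 0 < ρ) (m : ℕ) :
    ∃ C : ℝ≥0∞, C ≠ ⊤ ∧ ∀ f ∈ homSobolevZero (Ioo 0 ρ) ρ m α,
      sobNormSq (Ioo 0 ρ) m α f ≤ C * homNormSq (Ioo 0 ρ) m α f := by
  have h : ∀ k : ℕ, ∃ C : ℝ≥0∞, C ≠ ⊤ ∧ (k ≤ m → ∀ f ∈ homSobolevZero (Ioo 0 ρ) ρ m α,
      homNormSq (Ioo 0 ρ) k α f ≤ C * homNormSq (Ioo 0 ρ) m α f) := by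
    intro k
    rcases lt_trichotomy k m with hk | rfl | hk
    · obtain ⟨C, hC, hle⟩ := exists_homNormSq_le_of_lt (α := α) hρ hk
      exact ⟨C, hC, fun _ => hle⟩
    · exact ⟨1, ENNReal.one_ne_top, fun _ f _ => by rw [one_mul]⟩
    · exact ⟨0, ENNReal.zero_ne_top, fun hk' => by omega⟩
  choose C hC hle using h
  refine ⟨∑ k ∈ Finset.range (m + 1), C k, ENNReal.sum_ne_top.2 fun k _ => hC k, fun f hf => ?_⟩
  rw [sobNormSq, Finset.sum_mul]
  exact Finset.sum_le_sum fun k hk => hle k (by grind) f hf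

theorem homSobolevZero_subset_sobolevZero {ρ : ℝ} (α : ℝ) (hρ : 0 < ρ) (m : ℕ) :
    homSobolevZero (Ioo 0 ρ) ρ m α ⊆ sobolevZero (Ioo 0 ρ) m α := by
  obtain ⟨C, hC, hle⟩ := exists_sobNormSq_le α hρ m
  intro f hf
  refine ⟨⟨hf.1.1, (hle f hf).trans_lt (ENNReal.mul_lt_top hC.lt_top hf.1.2.2)⟩, fun ε hε => ?_⟩
  obtain ⟨δ, hδ0, hδ⟩ := ENNReal.exists_nnreal_pos_mul_lt hC hε.ne'
  rw [mul_comm] at hδ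
  -- The bound `1` makes `f - φ` an element of the homogeneous space.
  obtain ⟨φ, hφ, hlt⟩ := hf.2 (min δ 1) (lt_min (by exact_mod_cast hδ0) one_pos)
  refine ⟨φ, hφ, (hle _ (homSobolevZero_sub (isIntervalWithEndpoint_Ioo hρ) hf hφ
    (hlt.trans_le (min_le_right _ _) |>.trans ENNReal.one_lt_top))).trans_lt (hδ.trans_le' ?_)⟩
  gcongr
  exact hlt.le.trans (min_le_left _ _)

/-- The one-dimensional Sobolev inequality on `[a, b)`. -/
theorem enorm_sq_le_lintegral_Ico {G : ℝ → ℂ} {a b : ℝ}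
    (hG : ∀ x y : ℝ, x ≤ y → x ∈ Ico a b → y ∈ Ico a b → AbsolutelyContinuousOnInterval G x y)
    {x : ℝ} (hx : x ∈ Ico a b) :
    ENNReal.ofReal (b - a) * ‖G x‖ₑ ^ 2 ≤ 2 * (∫⁻ y in Ico a b, ‖G y‖ₑ ^ 2)
      + 2 * ENNReal.ofReal (b - a) ^ 2 * ∫⁻ y in Ico a b, ‖deriv G y‖ₑ ^ 2 := by
  set J := ∫⁻ y in Ico a b, ‖deriv G y‖ₑ ^ 2 with hJ
  have hpt : ∀ y ∈ Ico a b, ‖G x‖ₑ ^ 2 ≤ 2 * ‖G y‖ₑ ^ 2 + 2 * (ENNReal.ofReal (b - a) * J) := by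
    intro y hy
    have hac : AbsolutelyContinuousOnInterval G y x := by
      rcases le_total x y with h | h
      · exact (hG x y h hx hy).symm
      · exact hG y x h hy hx
    have h1 : ‖G x - G y‖ₑ ^ 2 ≤ ENNReal.ofReal (b - a) * J := by
      refine hac.enorm_sub_sq_le.trans ?_
      gcongr ENNReal.ofReal ?_ * ?_
      · rw [abs_le]
        constructor <;> linarith [hx.1, hx.2, hy.1, hy.2]
      · exact lintegral_mono_set (uIoc_subset_uIcc.trans (ordConnected_Ico.uIcc_subset hy hx))
    have h2 : ‖G x‖ₑ ≤ ‖G y‖ₑ + ‖G x - G y‖ₑ := by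
      have := enorm_add_le (G y) (G x - G y)
      rwa [add_sub_cancel] at this
    have h3 : ∀ u v : ℝ≥0∞, (u + v) ^ 2 ≤ 2 * u ^ 2 + 2 * v ^ 2 := fun u v => by
      rcases eq_or_ne u ⊤ with rfl | hu
      · simp
      rcases eq_or_ne v ⊤ with rfl | hv
      · simp
      lift u to NNReal using hu
      lift v to NNReal using hv
      rw [← mul_add]
      exact_mod_cast add_sq_le (a := u) (b := v)
    calc ‖G x‖ₑ ^ 2 ≤ (‖G y‖ₑ + ‖G x - G y‖ₑ) ^ 2 := by gcongr
      _ ≤ 2 * ‖G y‖ₑ ^ 2 + 2 * ‖G x - G y‖ₑ ^ 2 := h3 _ _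
      _ ≤ _ := by gcongr
  have h4 := setLIntegral_mono' (μ := volume) measurableSet_Ico hpt
  rw [setLIntegral_const, Real.volume_Ico, lintegral_add_right _ measurable_const,
    setLIntegral_const, Real.volume_Ico, lintegral_const_mul' _ _ (by simp)] at h4
  rw [mul_comm]
  refine h4.trans (le_of_eq ?_)
  ring

theorem sobolevZero_subset_homSobolevZero {ρ : ℝ} (α : ℝ) (hρ : 0 < ρ) (m : ℕ) :
    sobolevZero (Ioo 0 ρ) m α ⊆ homSobolevZero (Ioo 0 ρ) ρ m α := by
  have hU := isIntervalWithEndpoint_Ioo hρ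
  intro f hf
  have hle : ∀ (g : ℝ → ℂ) (k : ℕ), k ≤ m →
      homNormSq (Ioo 0 ρ) k α g ≤ sobNormSq (Ioo 0 ρ) m α g := fun g k hk =>
    Finset.single_le_sum (f := fun k => homNormSq (Ioo 0 ρ) k α g) (fun _ _ => bot_le)
      (Finset.mem_range.2 (by omega))
  refine ⟨⟨hf.1.1, fun k hk => ?_, (hle f m le_rfl).trans_lt hf.1.2⟩, fun ε hε => ?_⟩
  · have hmid : ρ / 2 ∈ Ioo 0 ρ := ⟨by linarith, by linarith⟩
    obtain ⟨C, hC, hCle⟩ := hU.exists_lintegral_le hmid α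
    have hset : Ico (ρ / 2) ρ ⊆ Ioo 0 ρ ∩ uIcc (ρ / 2) ρ := fun x hx => by
      rw [uIcc_of_le (by linarith)]
      exact ⟨⟨by linarith [hx.1], hx.2⟩, Ico_subset_Icc_self hx⟩
    set L := ENNReal.ofReal (ρ - ρ / 2) with hL
    have hL0 : L ≠ 0 := by rw [hL]; simp; linarith
    have hLtop : L ≠ ⊤ := ENNReal.ofReal_ne_top
    set M := L⁻¹ * (2 * C + 2 * L ^ 2 * C) with hM
    have hMtop : M ≠ ⊤ := by
      have := ENNReal.inv_ne_top.2 hL0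
      finiteness
    -- The endpoint `ρ` has a neighbourhood where `φ` vanishes, so there `f` and `f - φ` agree.
    have hev : ∀ φ ∈ testFunctions (Ioo 0 ρ), ∀ᶠ x in 𝓝[Ioo 0 ρ] ρ,
        ‖iteratedDeriv k f x‖ₑ ^ 2 ≤ M * sobNormSq (Ioo 0 ρ) m α (f - φ) := by
      intro φ hφ
      have hφk := testFunctions_iteratedDeriv hφ k
      have hnhds : (tsupport (iteratedDeriv k φ))ᶜ ∈ 𝓝 ρ :=
        (isClosed_tsupport _).isOpen_compl.mem_nhds fun h => hU.notMem (hφk.2.2 h)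
      filter_upwards [hU.eventually_mem _ hmid, self_mem_nhdsWithin,
        mem_nhdsWithin_of_mem_nhds hnhds] with x hx hxU hxs
      have hxI : x ∈ Ico (ρ / 2) ρ := by
        rw [uIcc_of_le (by linarith)] at hx
        exact ⟨hx.1, hxU.2⟩
      have hsub := hf.1.1.iteratedDeriv_sub hU.isOpen hφ hk hxU
      rw [Pi.sub_apply, image_eq_zero_of_notMem_tsupport hxs, sub_zero] at hsub
      rw [← hsub]
      have h1 := enorm_sq_le_lintegral_Ico (G := iteratedDeriv k (f - φ)) (a := ρ / 2) (b := ρ)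
        (fun y z hyz hy hz => hf.1.1.sub hU.isOpen hφ k hk y z hyz fun t ht =>
          ⟨by linarith [hy.1, ht.1], ht.2.trans_lt hz.2⟩) hxI
      rw [← iteratedDeriv_succ] at h1
      have h2 : ∀ i ≤ m, ∫⁻ y in Ico (ρ / 2) ρ, ‖iteratedDeriv i (f - φ) y‖ₑ ^ 2
          ≤ C * sobNormSq (Ioo 0 ρ) m α (f - φ) := fun i hi =>
        (lintegral_mono_set hset).trans ((hCle i (f - φ)).trans (by gcongr; exact hle _ i hi))
      have h3 : L * ‖iteratedDeriv k (f - φ) x‖ₑ ^ 2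
          ≤ (2 * C + 2 * L ^ 2 * C) * sobNormSq (Ioo 0 ρ) m α (f - φ) := by
        refine h1.trans ?_
        rw [add_mul, mul_assoc 2 C, mul_assoc (2 * L ^ 2) C]
        gcongr
        · exact h2 k hk.le
        · exact h2 (k + 1) hk
      rw [hM, mul_assoc]
      calc _ = L⁻¹ * (L * ‖iteratedDeriv k (f - φ) x‖ₑ ^ 2) := by
            rw [← mul_assoc, ENNReal.inv_mul_cancel hL0 hLtop, one_mul]
        _ ≤ _ := by gcongr
    rw [tendsto_zero_iff_enorm_tendsto_zero, ENNReal.tendsto_nhds_zero]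
    intro ε hε
    obtain ⟨δ, hδ0, hδ⟩ := ENNReal.exists_nnreal_pos_mul_lt hMtop (pow_ne_zero 2 hε.ne')
    obtain ⟨φ, hφ, hlt⟩ := hf.2 δ (by exact_mod_cast hδ0)
    filter_upwards [hev φ hφ] with x hx
    by_contra! hcon
    refine (hx.trans_lt ?_).not_ge (pow_le_pow_left₀ bot_le hcon.le 2)
    refine lt_of_le_of_lt ?_ hδ
    rw [mul_comm (δ : ℝ≥0∞)]
    gcongr
  · obtain ⟨φ, hφ, hlt⟩ := hf.2 ε hε
    exact ⟨φ, hφ, (hle _ m le_rfl).trans_lt hlt⟩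

theorem theorem3p5 (ℓ m N : ℕ) (α ρ γ τ : ℝ) (hℓ : 1 ≤ ℓ) (hℓm : ℓ ≤ m) (hN : 1 ≤ N)
    (hρ : 0 < ρ) (hγ : 0 < γ) (hτ : 0 < τ) :
    (iterExp N * γ ≤ ρ → ∀ f ∈ homSobolevZero (Ioi ρ) ρ m α,
      refinedSum (Ioi ρ) ℓ N α (fun p x => (iterLog p (x / γ))⁻¹) (iteratedDeriv (m - ℓ) f)
        ≤ ∫⁻ x in Ioi ρ, ENNReal.ofReal (x ^ α * ‖iteratedDeriv m f x‖ ^ 2)) ∧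
    (τ ≤ ρ → ∀ f ∈ homSobolevZero (Ioi ρ) ρ m α,
      refinedSum (Ioi ρ) ℓ N α (fun p x => normLog p (τ / x)) (iteratedDeriv (m - ℓ) f)
        ≤ ∫⁻ x in Ioi ρ, ENNReal.ofReal (x ^ α * ‖iteratedDeriv m f x‖ ^ 2)) ∧
    homSobolevZero (Ioo 0 ρ) ρ m α = sobolevZero (Ioo 0 ρ) m α ∧
    (iterExp N * ρ ≤ γ → ∀ f ∈ homSobolevZero (Ioo 0 ρ) ρ m α,
      refinedSum (Ioo 0 ρ) ℓ N α (fun p x => (iterLog p (γ / x))⁻¹) (iteratedDeriv (m - ℓ) f)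
        ≤ ∫⁻ x in Ioo 0 ρ, ENNReal.ofReal (x ^ α * ‖iteratedDeriv m f x‖ ^ 2)) ∧
    (ρ ≤ τ → ∀ f ∈ homSobolevZero (Ioo 0 ρ) ρ m α,
      refinedSum (Ioo 0 ρ) ℓ N α (fun p x => normLog p (x / τ)) (iteratedDeriv (m - ℓ) f)
        ≤ ∫⁻ x in Ioo 0 ρ, ENNReal.ofReal (x ^ α * ‖iteratedDeriv m f x‖ ^ 2)) := by
  have hI := isIntervalWithEndpoint_Ioi hρ
  have hJ := isIntervalWithEndpoint_Ioo hρ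
  refine ⟨fun h f hf => ?_, fun h f hf => ?_, ?_, fun h f hf => ?_, fun h f hf => ?_⟩
  · exact refinedSum_le_of_testFunctions hI hℓ hℓm
      (fun p => ((measurable_iterLog p).comp (measurable_id.div_const γ)).inv)
      (fun φ hφ => refinedSum_le_of_iterLog_div hγ hN hℓ h hφ) hf
  · exact refinedSum_le_of_testFunctions hI hℓ hℓm
      (fun p => (measurable_normLog p).comp (measurable_id.const_div τ))
      (fun φ hφ => refinedSum_le_of_normLog_div hτ hN hℓ h hφ) hf
  · exact (homSobolevZero_subset_sobolevZero α hρ m).antisymm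
      (sobolevZero_subset_homSobolevZero α hρ m)
  · exact refinedSum_le_of_testFunctions hJ hℓ hℓm
      (fun p => ((measurable_iterLog p).comp (measurable_id.const_div γ)).inv)
      (fun φ hφ => refinedSum_le_of_iterLog_div' hρ hN hℓ h hφ) hf
  · exact refinedSum_le_of_testFunctions hJ hℓ hℓm
      (fun p => (measurable_normLog p).comp (measurable_id.div_const τ))
      (fun φ hφ => refinedSum_le_of_normLog_div' hτ hN hℓ h hφ) hf
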